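/- Let $X$ be a topological space and let $\mathrm{Off}(X)$ be the poset of its open subsets. A \emph{2-functor} on $X$ is a (pseudo)functor from $\mathrm{Off}(X)$ to the 2-category $\mathbf{Grp}$ of small groupoids, functors and natural transformations. The 2-functors on $X$ form a 2-category whose 1-morphisms are the pseudonatural transformations and whose 2-morphisms are the modifications. A 2-functor $G$ is a \emph{costack} if, for every family $(U_i)_{i\in I}$ of open subsets of $X$ with union $U$, the groupoid $G(U)$ is the 2-colimit of the diagram of inclusion-induced functors $$\coprod_{i,j,k}G(U_i\cap U_j\cap U_k)\Rrightarrow \coprod_{i,j}G(U_i\cap U_j)\rightrightarrows\coprod_i G(U_i);$$ that is, for every groupoid $D$ the canonical functor from $\mathrm{Hom}(G(U),D)$ to the category of families of functors $a_i:G(U_i)\to D$ with isomorphisms between the functors induced by $a_i$ and $a_j$ on $G(U_i\cap U_j)$, satisfying the cocycle condition on all $G(U_i\cap U_j\cap U_k)$, is an equivalence. The 2-category of costacks on $X$ is the full sub-2-category on the costacks. A costack $\hat G$ with a morphism $\varepsilon:\hat G\to G$ is the \emph{associated costack} (costackification) of a 2-functor $G$ if, for every costack $Q$, composition with $\varepsilon$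 is an equivalence of categories $\mathrm{Hom}(Q,\hat G)\to\mathrm{Hom}(Q,G)$. An object $t$ of a 2-category is \emph{2-terminal} if for every object $x$ the category $\mathrm{Hom}(x,t)$ is equivalent to the groupoid $\mathbf 1$ with one object and one morphism. Call $X$ \emph{good} if every open subset $U$ of $X$ has an open covering $U=\bigcup_i U_i$ such that all $U_i$, and all nonempty intersections $U_i\cap U_j$ and $U_i\cap U_j\cap U_k$, are simply connected. \textbf{Theorem.} Let $X$ be a good topological space, and let $P$ be the constant functor $U\mapsto\mathbf 1$ on $\mathrm{Off}(X)$. Then $P$ has an associated costack, namely the functor $U\mapsto\Pi_1(U)$ sending an open subset to its fundamental groupoid (objects: points of $U$; morphisms: homotopy classes of paths in $U$). Consequently $U\mapsto\Pi_1(U)$ is a costack and is a 2-terminal object of the 2-category of costacks on $X$. -/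

import Mathlib

open CategoryTheory TopologicalSpace Bicategory
open scoped CategoryTheory.Pseudofunctor.StrongTrans

universe u

noncomputable section

namespace Costacks

/-- The 2-category of small groupoids: objects are groupoids, 1-morphisms are functors and
2-morphisms are natural transformations. -/
instance grpdBicategory : Bicategory Grpd.{u, u} where
  toCategoryStruct := Grpd.category.toCategoryStruct
  homCategory C D := inferInstanceAs (Category (C ⥤ D))
  whiskerLeft {C D E} (F : C ⥤ D) (G H : D ⥤ E) (α : G ⟶ H) := Functor.whiskerLeft F α
  whiskerRight {C D E} (F G : C ⥤ D) (α : F ⟶ G) (H : D ⥤ E) := Functor.whiskerRight α H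
  associator {A B C D} (F : A ⥤ B) (G : B ⥤ C) (H : C ⥤ D) := Functor.associator F G H
  leftUnitor {A B} (F : A ⥤ B) := Functor.leftUnitor F
  rightUnitor {A B} (F : A ⥤ B) := Functor.rightUnitor F
  whiskerLeft_id _ _ := Functor.whiskerLeft_id' _
  whiskerLeft_comp _ _ _ _ _ _ := Functor.whiskerLeft_comp _ _ _
  id_whiskerLeft _ := by
    apply NatTrans.ext; funext x
    exact ((Category.id_comp _).trans (Category.comp_id _)).symm
  comp_whiskerLeft _ _ _ _ _ := by
    apply NatTrans.ext; funext x
    exact ((Category.id_comp _).trans (Category.comp_id _)).symm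
  id_whiskerRight _ _ := Functor.whiskerRight_id' _
  comp_whiskerRight _ _ _ := Functor.whiskerRight_comp _ _ _
  whiskerRight_id _ := by
    apply NatTrans.ext; funext x
    exact ((Category.id_comp _).trans (Category.comp_id _)).symm
  whiskerRight_comp _ _ _ := by
    apply NatTrans.ext; funext x
    exact ((Category.id_comp _).trans (Category.comp_id _)).symm
  whisker_assoc _ _ _ _ _ := by
    apply NatTrans.ext; funext x
    exact ((Category.id_comp _).trans (Category.comp_id _)).symm
  whisker_exchange α β := by
    apply NatTrans.ext; funext x
    exact (β.naturality _).symm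
  pentagon {A B C D E} (F : A ⥤ B) (G : B ⥤ C) (H : C ⥤ D) (K : D ⥤ E) :=
    Functor.pentagon F G H K
  triangle {A B C} (F : A ⥤ B) (G : B ⥤ C) := Functor.triangle F G

/-- 2-functors from the poset of open subsets of `X` to the 2-category of groupoids. -/
abbrev OpenFunctor (X : Type u) [TopologicalSpace X] : Type (u + 1) :=
  LocallyDiscrete (Opens X) ⥤ᵖ Grpd.{u, u}

section

variable {X : Type u} [TopologicalSpace X]

/-- A strict functor from the poset of opens to groupoids, regarded as a 2-functor. -/
def ofFunctor (F : Opens X ⥤ Grpd.{u, u}) : OpenFunctor X :=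
  LocallyDiscrete.mkPseudofunctor F.obj F.map
    (fun U => eqToIso (F.map_id U)) (fun f g => eqToIso (F.map_comp f g))
    (fun f g h => by
      rw [show α_ (F.map f) (F.map g) (F.map h) = eqToIso rfl from rfl]
      simp)
    (fun f => by
      rw [show λ_ (F.map f) = eqToIso rfl from rfl]
      simp)
    (fun f => by
      rw [show ρ_ (F.map f) = eqToIso rfl from rfl]
      simp)

namespace OpenFunctor

variable (F : OpenFunctor X)

/-- The groupoid `F(U)`. -/
abbrev val (U : Opens X) : Grpd.{u, u} := F.obj ⟨U⟩

/-- The functor `F(V) ⥤ F(U)` for `V ⊆ U`. -/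
def push {V U : Opens X} (h : V ≤ U) : F.val V ⥤ F.val U := F.map (homOfLE h).toLoc

/-- The coherence isomorphism between `F(W) ⥤ F(U)` and `F(W) ⥤ F(V) ⥤ F(U)`. -/
def pushComp {W V U : Opens X} (h₁ : W ≤ V) (h₂ : V ≤ U) :
    F.push (h₁.trans h₂) ≅ F.push h₁ ⋙ F.push h₂ :=
  F.mapComp (homOfLE h₁).toLoc (homOfLE h₂).toLoc

/-- Compatibility of the coherence isomorphisms for `T ⊆ W ⊆ V ⊆ U`. -/
theorem pushComp_assoc {T W V U : Opens X} (h₁ : T ≤ W) (h₂ : W ≤ V) (h₃ : V ≤ U) (x : F.val T) :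
    (F.pushComp (h₁.trans h₂) h₃).hom.app x ≫ (F.push h₃).map ((F.pushComp h₁ h₂).hom.app x) =
      (F.pushComp h₁ (h₂.trans h₃)).hom.app x ≫ (F.pushComp h₂ h₃).hom.app ((F.push h₁).obj x) := by
  have h := F.mapComp_assoc_right_hom (homOfLE h₁).toLoc (homOfLE h₂).toLoc (homOfLE h₃).toLoc
  rw [show F.map₂ (α_ (homOfLE h₁).toLoc (homOfLE h₂).toLoc (homOfLE h₃).toLoc).inv = 𝟙 _ from
    F.map₂_id _, Category.id_comp] at h
  refine Eq.trans ?_ (congrArg (fun t => NatTrans.app t x) h).symm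
  exact congrArg (_ ≫ ·) (Category.comp_id _).symm

end OpenFunctor

variable {ι : Type u}

/-- Given functors `a i : F(U i) ⥤ D` and isomorphisms `φ i j` between the two induced functors
on `F(U i ∩ U j)`, the component at `x` of the restriction of `φ i j` to `F(W)`,
for `W ⊆ U i ∩ U j`. -/
def restrictHom (F : OpenFunctor X) {U : ι → Opens X} {D : Grpd.{u, u}}
    (a : ∀ i, F.val (U i) ⥤ D)
    (φ : ∀ i j, F.push (inf_le_left : U i ⊓ U j ≤ U i) ⋙ a i ≅
      F.push (inf_le_right : U i ⊓ U j ≤ U j) ⋙ a j)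
    {W : Opens X} {i j : ι} (hi : W ≤ U i) (hj : W ≤ U j) (x : F.val W) :
    (a i).obj ((F.push hi).obj x) ⟶ (a j).obj ((F.push hj).obj x) :=
  (a i).map ((F.pushComp (le_inf hi hj) inf_le_left).hom.app x) ≫
    (φ i j).hom.app ((F.push (le_inf hi hj)).obj x) ≫
    (a j).map ((F.pushComp (le_inf hi hj) inf_le_right).inv.app x)

/-- The objects of the 2-limit of
`∏ᵢ Hom(F(U i), D) ⇉ ∏ᵢⱼ Hom(F(U i ∩ U j), D) ⇛ ∏ᵢⱼₖ Hom(F(U i ∩ U j ∩ U k), D)`, that is, the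
cocones with vertex `D` under
`∐ᵢⱼₖ F(U i ∩ U j ∩ U k) ⇛ ∐ᵢⱼ F(U i ∩ U j) ⇉ ∐ᵢ F(U i)`: families of functors together with
isomorphisms on double intersections which satisfy the cocycle condition on triple
intersections. -/
structure Cocone (F : OpenFunctor X) (U : ι → Opens X) (D : Grpd.{u, u}) where
  obj (i : ι) : F.val (U i) ⥤ D
  iso (i j : ι) : F.push (inf_le_left : U i ⊓ U j ≤ U i) ⋙ obj i ≅
    F.push (inf_le_right : U i ⊓ U j ≤ U j) ⋙ obj j
  cocycle (i j k : ι) (x : F.val (U i ⊓ U j ⊓ U k)) :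
    restrictHom F obj iso (inf_le_left.trans inf_le_left) (inf_le_left.trans inf_le_right) x ≫
      restrictHom F obj iso (inf_le_left.trans inf_le_right) inf_le_right x =
    restrictHom F obj iso (inf_le_left.trans inf_le_left) inf_le_right x

namespace Cocone

variable {F : OpenFunctor X} {U : ι → Opens X} {D : Grpd.{u, u}}

/-- The morphisms of the 2-limit: families of natural transformations that are compatible with
the isomorphisms on double intersections. -/
@[ext]
structure Hom (A B : Cocone F U D) where
  app (i : ι) : A.obj i ⟶ B.obj i
  comm (i j : ι) : Functor.whiskerLeft (F.push inf_le_left) (app i) ≫ (B.iso i j).hom =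
    (A.iso i j).hom ≫ Functor.whiskerLeft (F.push inf_le_right) (app j)

instance category : Category (Cocone F U D) where
  Hom := Hom
  id A := { app i := 𝟙 (A.obj i), comm i j := by simp }
  comp f g :=
    { app i := f.app i ≫ g.app i
      comm i j := by
        rw [Functor.whiskerLeft_comp, Functor.whiskerLeft_comp, Category.assoc, g.comm,
          ← Category.assoc, f.comm, Category.assoc] }
  id_comp _ := Hom.ext (funext fun _ => Category.id_comp _)
  comp_id _ := Hom.ext (funext fun _ => Category.comp_id _)
  assoc _ _ _ := Hom.ext (funext fun _ => Category.assoc _ _ _)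

end Cocone

/-- The isomorphism on `F(U i ∩ U j)` between the two restrictions of a functor `F(⋃ U i) ⥤ D`. -/
def restrictIso (F : OpenFunctor X) (U : ι → Opens X) {D : Grpd.{u, u}}
    (G : F.val (⨆ i, U i) ⥤ D) (i j : ι) :
    F.push (inf_le_left : U i ⊓ U j ≤ U i) ⋙ F.push (le_iSup U i) ⋙ G ≅
      F.push (inf_le_right : U i ⊓ U j ≤ U j) ⋙ F.push (le_iSup U j) ⋙ G :=
  Functor.isoWhiskerRight
    ((F.pushComp (inf_le_left : U i ⊓ U j ≤ U i) (le_iSup U i)).symm ≪≫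
      F.pushComp (inf_le_right : U i ⊓ U j ≤ U j) (le_iSup U j)) G

theorem conj_eq {C : Type*} [Category C] {a b d e b' d' : C} (A : a ≅ b) (m : b ≅ d) (E : a ≅ e)
    (P : e ≅ d) (A' : a ≅ b') (m' : b' ≅ d') (P' : e ≅ d')
    (h : A.hom ≫ m.hom = E.hom ≫ P.hom) (h' : A'.hom ≫ m'.hom = E.hom ≫ P'.hom) :
    m.hom ≫ (P.inv ≫ P'.hom) ≫ m'.inv = A.inv ≫ A'.hom := by
  rw [← cancel_epi A.hom, ← Category.assoc, h, ← cancel_mono m'.hom]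
  simp [h']

theorem restrictHom_restrictIso (F : OpenFunctor X) (U : ι → Opens X) {D : Grpd.{u, u}}
    (G : F.val (⨆ i, U i) ⥤ D) {W : Opens X} {i j : ι} (hi : W ≤ U i) (hj : W ≤ U j)
    (x : F.val W) :
    restrictHom F (fun i => F.push (le_iSup U i) ⋙ G) (restrictIso F U G) hi hj x =
      G.map ((F.pushComp hi (le_iSup U i)).inv.app x ≫ (F.pushComp hj (le_iSup U j)).hom.app x) := by
  have h₁ := F.pushComp_assoc (le_inf hi hj) (inf_le_left : U i ⊓ U j ≤ U i) (le_iSup U i) x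
  have h₂ := F.pushComp_assoc (le_inf hi hj) (inf_le_right : U i ⊓ U j ≤ U j) (le_iSup U j) x
  change G.map _ ≫ G.map _ ≫ G.map _ = _
  rw [← G.map_comp, ← G.map_comp]
  congr 1
  exact conj_eq ((F.pushComp hi (le_iSup U i)).app x)
    ((F.push (le_iSup U i)).mapIso ((F.pushComp (le_inf hi hj) inf_le_left).app x))
    ((F.pushComp (le_inf hi hj) (inf_le_left.trans (le_iSup U i))).app x)
    ((F.pushComp (inf_le_left : U i ⊓ U j ≤ U i) (le_iSup U i)).app _)
    ((F.pushComp hj (le_iSup U j)).app x)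
    ((F.push (le_iSup U j)).mapIso ((F.pushComp (le_inf hi hj) inf_le_right).app x))
    ((F.pushComp (inf_le_right : U i ⊓ U j ≤ U j) (le_iSup U j)).app _) h₁ h₂

/-- The canonical functor from `Hom(F(⋃ U i), D)` to the 2-limit, which restricts a functor to
the `F(U i)`. -/
def toCocone (F : OpenFunctor X) (U : ι → Opens X) (D : Grpd.{u, u}) :
    (F.val (⨆ i, U i) ⥤ D) ⥤ Cocone F U D where
  obj G :=
    { obj i := F.push (le_iSup U i) ⋙ G
      iso := restrictIso F U G
      cocycle i j k x := by
        rw [restrictHom_restrictIso, restrictHom_restrictIso, restrictHom_restrictIso,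
          ← G.map_comp]
        congr 1
        rw [Category.assoc, Iso.hom_inv_id_app_assoc] }
  map {G H} α :=
    { app i := Functor.whiskerLeft (F.push (le_iSup U i)) α
      comm i j := by
        ext x
        exact (α.naturality _).symm }
  map_id _ := rfl
  map_comp _ _ := rfl

/-- `F` is a costack if, for every family of open sets `U i`, the groupoid `F(⋃ U i)` is the
2-colimit of `∐ᵢⱼₖ F(U i ∩ U j ∩ U k) ⇛ ∐ᵢⱼ F(U i ∩ U j) ⇉ ∐ᵢ F(U i)`. -/
def IsCostack (F : OpenFunctor X) : Prop :=
  ∀ (ι : Type u) (U : ι → Opens X) (D : Grpd.{u, u}), (toCocone F U D).IsEquivalence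

/-- `p : G' ⟶ G` exhibits `G'` as the associated costack of `G`: `G'` is a costack, and every
morphism from a costack to `G` factors through `p`, up to a 2-isomorphism and essentially uniquely,
in the sense that composition with `p` is an equivalence of categories. -/
structure IsAssociatedCostack {G' G : OpenFunctor X} (p : G' ⟶ G) : Prop where
  isCostack : IsCostack G'
  isEquivalence (Q : OpenFunctor X) (hQ : IsCostack Q) : (postcomp Q p).IsEquivalence

end

section

variable (X : Type u) [TopologicalSpace X]

/-- Costacks on `X`. -/
structure Costack where
  toOpenFunctor : OpenFunctor X
  isCostack : IsCostack toOpenFunctor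

/-- The 2-category of costacks on `X`: the full sub-2-category of the 2-category of 2-functors,
(pseudo)natural transformations and modifications. -/
abbrev CostackCat : Type (u + 1) :=
  InducedBicategory (OpenFunctor X) (Costack.toOpenFunctor (X := X))

/-- The 2-functor `U ↦ Π₁(U)`. -/
def fundamentalGroupoid : OpenFunctor X :=
  ofFunctor (Opens.toTopCat (TopCat.of X) ⋙ FundamentalGroupoid.fundamentalGroupoidFunctor)

/-- The constant 2-functor whose value is the groupoid with one object and one morphism. -/
def constOne : OpenFunctor X :=
  ofFunctor ((Functor.const (Opens X)).obj (Grpd.of (Discrete PUnit.{u + 1})))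

/-- Every open subset has an open covering whose members, and whose nonempty double and triple
intersections, are simply connected. -/
def IsGood : Prop :=
  ∀ U : Opens X, ∃ (ι : Type u) (V : ι → Opens X), ⨆ i, V i = U ∧
    (∀ i, IsSimplyConnected (V i : Set X)) ∧
    (∀ i j, (V i ∩ V j : Set X).Nonempty → IsSimplyConnected (V i ∩ V j : Set X)) ∧
    (∀ i j k, (V i ∩ V j ∩ V k : Set X).Nonempty → IsSimplyConnected (V i ∩ V j ∩ V k : Set X))

end

/-- An object `t` of a 2-category is 2-terminal if every category `Hom(x, t)` is equivalent to the
category with one object and one morphism. -/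
def IsTwoTerminal {B : Type*} [Bicategory B] (t : B) : Prop :=
  ∀ x : B, Nonempty ((x ⟶ t) ≌ Discrete PUnit.{1})

end Costacks

end

/-! Every hom category in the theorem is contractible, that is, nonempty with exactly one morphism
between any two objects. On a good space the simply connected open subsets form a base `B` in the
sense of `IsBase`, and both `U ↦ Π₁(U)` and the constant 2-functor take contractible values on `B`.
The central statement is `isContractible_hom`: if `Q` is a costack and `P` is any 2-functor with
contractible values on `B`, then `Hom(Q, P)` is contractible. Indeed functors out of `Q(U)`, and
natural transformations between them, can be glued from the members of `B` inside `U`; on those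
members contractibility of `P` leaves one choice up to unique isomorphism, and all coherence
conditions can be tested there.

Once Π₁ is known to be a costack, a morphism `p` from Π₁ to the constant 2-functor exists by the
case `Q = Π₁`. Composition with any such `p` is a functor between contractible categories, hence an
equivalence, and 2-terminality of Π₁ is contractibility of `Hom(Q, Π₁)`.

That Π₁ is a costack (`isCostack_fundamentalGroupoid`) is the van Kampen theorem for groupoids and
arbitrary open coverings. A cocone defines a transport along each path lying in one member of the
covering, and the cocycle condition makes it independent of that member. Dyadic subdivision below a
Lebesgue number extends it to all paths (`LocalTransport.transport`), and subdivision of squares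
gives homotopy invariance (`LocalTransport.transport_square`). -/

namespace Costacks

open scoped unitInterval

/-! ### Cutting paths at the midpoint of the unit interval. -/

section Halves

/-- The affine map from the unit interval onto its lower half. -/
noncomputable def lowerHalf : C(I, I) where
  toFun t := ⟨t / 2, by constructor <;> linarith [t.2.1, t.2.2]⟩
  continuous_toFun := by fun_prop

/-- The affine map from the unit interval onto its upper half. -/
noncomputable def upperHalf : C(I, I) where
  toFun t := ⟨(1 + t) / 2, by constructor <;> linarith [t.2.1, t.2.2]⟩
  continuous_toFun := by fun_prop

@[simp] theorem coe_lowerHalf (t : I) : (lowerHalf t : ℝ) = t / 2 := rfl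

@[simp] theorem coe_upperHalf (t : I) : (upperHalf t : ℝ) = (1 + t) / 2 := rfl

@[simp] theorem lowerHalf_zero : lowerHalf 0 = 0 := Subtype.ext (by simp)

@[simp] theorem upperHalf_one : upperHalf 1 = 1 := Subtype.ext (by norm_num)

@[simp] theorem upperHalf_zero : upperHalf 0 = lowerHalf 1 := Subtype.ext (by simp)

theorem dist_lowerHalf (s t : I) : dist (lowerHalf s) (lowerHalf t) = dist s t / 2 := by
  rw [Subtype.dist_eq, Subtype.dist_eq, Real.dist_eq, Real.dist_eq, coe_lowerHalf, coe_lowerHalf,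
    ← sub_div, abs_div, abs_two]

theorem dist_upperHalf (s t : I) : dist (upperHalf s) (upperHalf t) = dist s t / 2 := by
  rw [Subtype.dist_eq, Subtype.dist_eq, Real.dist_eq, Real.dist_eq, coe_upperHalf, coe_upperHalf,
    ← sub_div, add_sub_add_left_eq_sub, abs_div, abs_two]

variable {Y : Type*} [TopologicalSpace Y] {x y z : Y}

@[simp] theorem trans_lowerHalf (γ : Path x y) (δ : Path y z) (t : I) :
    (γ.trans δ) (lowerHalf t) = γ t := by
  rw [Path.trans_apply, dif_pos (by rw [coe_lowerHalf]; linarith [t.2.2])]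
  congr 1
  exact Subtype.ext (by simp; ring)

@[simp] theorem trans_upperHalf (γ : Path x y) (δ : Path y z) (t : I) :
    (γ.trans δ) (upperHalf t) = δ t := by
  rcases eq_or_ne t 0 with rfl | ht
  · rw [upperHalf_zero, trans_lowerHalf]; simp
  · have h : (0 : ℝ) < t := unitInterval.pos_iff_ne_zero.mpr ht
    rw [Path.trans_apply, dif_neg (by rw [coe_upperHalf]; linarith)]
    congr 1
    exact Subtype.ext (by simp; ring)

theorem eq_lowerHalf_or_upperHalf (t : I) : (∃ s, t = lowerHalf s) ∨ ∃ s, t = upperHalf s := by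
  rcases le_total (t : ℝ) (1 / 2) with h | h
  · exact .inl ⟨⟨2 * t, by constructor <;> linarith [t.2.1]⟩, Subtype.ext (by simp)⟩
  · exact .inr ⟨⟨2 * t - 1, by constructor <;> linarith [t.2.2]⟩, Subtype.ext (by simp)⟩

theorem eq_trans_of_halves {γ : Path x z} {γ₁ : Path x y} {γ₂ : Path y z}
    (h₁ : ∀ t, γ (lowerHalf t) = γ₁ t) (h₂ : ∀ t, γ (upperHalf t) = γ₂ t) : γ = γ₁.trans γ₂ := by
  ext t
  rcases eq_lowerHalf_or_upperHalf t with ⟨s, rfl⟩ | ⟨s, rfl⟩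
  · rw [h₁, trans_lowerHalf]
  · rw [h₂, trans_upperHalf]

/-- Concatenation always joins at time `1 / 2`, so the two halves can be read off from the
composite. The equalities are heterogeneous because the midpoints `y` and `y'` agree only
propositionally. -/
theorem trans_injective {y' : Y} {γ₁ : Path x y} {γ₂ : Path y z} {δ₁ : Path x y'} {δ₂ : Path y' z}
    (h : γ₁.trans γ₂ = δ₁.trans δ₂) : y = y' ∧ γ₁ ≍ δ₁ ∧ γ₂ ≍ δ₂ := by
  have h₁ (t : I) : γ₁ t = δ₁ t := by
    rw [← trans_lowerHalf γ₁ γ₂, h, trans_lowerHalf]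
  have h₂ (t : I) : γ₂ t = δ₂ t := by
    rw [← trans_upperHalf γ₁ γ₂, h, trans_upperHalf]
  obtain rfl : y = y' := by rw [← γ₁.target, h₁, δ₁.target]
  exact ⟨rfl, heq_of_eq (Path.ext (funext h₁)), heq_of_eq (Path.ext (funext h₂))⟩

/-- The restriction of a path to the lower half of the unit interval. -/
noncomputable def lowerPath (γ : Path x z) : Path x (γ (lowerHalf 1)) where
  toContinuousMap := γ.toContinuousMap.comp lowerHalf
  source' := by simp
  target' := by simp

/-- The restriction of a path to the upper half of the unit interval. -/
noncomputable def upperPath (γ : Path x z) : Path (γ (lowerHalf 1)) z where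
  toContinuousMap := γ.toContinuousMap.comp upperHalf
  source' := by simp
  target' := by simp

theorem lowerPath_trans_upperPath (γ : Path x z) : (lowerPath γ).trans (upperPath γ) = γ :=
  (eq_trans_of_halves (fun _ => rfl) (fun _ => rfl)).symm

theorem le_two_pow_mul {δ : ℝ} (hδ : 0 < δ) : ∃ n : ℕ, 1 < 2 ^ n * δ := by
  obtain ⟨n, hn⟩ := pow_unbounded_of_one_lt δ⁻¹ one_lt_two
  exact ⟨n, by rwa [inv_lt_iff_one_lt_mul₀ hδ] at hn⟩

end Halves

/-! ### Induction on paths and squares by subdivision below a Lebesgue number. -/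

section Small

variable {Y : Type*} [TopologicalSpace Y] {ι : Type*} (V : ι → Set Y)

/-- A path is small with respect to a family of sets if it is contained in one of them. -/
abbrev IsSmall {x y : Y} (γ : Path x y) : Prop := ∃ i, ∀ t, γ t ∈ V i

variable {V}

theorem IsSmall.left {x y z : Y} {γ : Path x y} {δ : Path y z} (h : IsSmall V (γ.trans δ)) :
    IsSmall V γ :=
  h.imp fun _ hi t => trans_lowerHalf γ δ t ▸ hi _

theorem IsSmall.right {x y z : Y} {γ : Path x y} {δ : Path y z} (h : IsSmall V (γ.trans δ)) :
    IsSmall V δ :=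
  h.imp fun _ hi t => trans_upperHalf γ δ t ▸ hi _

/-- A property of paths that holds for all small paths with respect to an open covering and
is stable under concatenation holds for all paths. -/
theorem path_induction (hV : ∀ i, IsOpen (V i)) (hcov : ∀ y, ∃ i, y ∈ V i)
    {P : ∀ {x y : Y}, Path x y → Prop} (small : ∀ {x y : Y} (γ : Path x y), IsSmall V γ → P γ)
    (trans : ∀ {x y z : Y} (γ : Path x y) (δ : Path y z), P γ → P δ → P (γ.trans δ))
    {x y : Y} (γ : Path x y) : P γ := by
  -- `δ` plays the role of a Lebesgue number. Passing to a half of the path doubles it, so `n`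
  -- halvings bring it above `1`, the diameter of the interval, where a single member of the
  -- covering suffices.
  have key (n : ℕ) : ∀ {x y : Y} (γ : Path x y) (δ : ℝ), 1 < 2 ^ n * δ →
      (∀ s, ∃ i, ∀ t, dist t s < δ → γ t ∈ V i) → P γ := by
    induction n with
    | zero =>
      intro x y γ δ hδ h
      obtain ⟨i, hi⟩ := h 0
      refine small γ ⟨i, fun t => hi t (lt_of_le_of_lt ?_ (by simpa using hδ))⟩
      rw [Subtype.dist_eq, Real.dist_eq]
      exact abs_le.mpr ⟨by simp; linarith [t.2.1], by simpa using t.2.2⟩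
    | succ n ih =>
      intro x y γ δ hδ h
      rw [pow_succ, mul_assoc] at hδ
      rw [← lowerPath_trans_upperPath γ]
      refine trans _ _ (ih _ (2 * δ) hδ fun s => ?_) (ih _ (2 * δ) hδ fun s => ?_)
      · obtain ⟨i, hi⟩ := h (lowerHalf s)
        exact ⟨i, fun t ht => hi _ (by rw [dist_lowerHalf]; linarith)⟩
      · obtain ⟨i, hi⟩ := h (upperHalf s)
        exact ⟨i, fun t ht => hi _ (by rw [dist_upperHalf]; linarith)⟩
  obtain ⟨δ, hδ, h⟩ := lebesgue_number_lemma_of_metric (c := fun i => γ ⁻¹' V i) isCompact_univ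
    (fun i => (hV i).preimage γ.continuous) fun t _ => Set.mem_iUnion.mpr (hcov (γ t))
  obtain ⟨n, hn⟩ := le_two_pow_mul hδ
  exact key n γ δ hn fun s => (h s trivial).imp fun i hi t ht => hi ht

/-- The four paths are the sides of a square in `Y`. -/
structure IsBoundary (f : C(I × I, Y)) {x y z w : Y} (b : Path x y) (r : Path y w) (l : Path x z)
    (t : Path z w) : Prop where
  bottom (s : I) : f (s, 0) = b s
  right (s : I) : f (1, s) = r s
  left (s : I) : f (0, s) = l s
  top (s : I) : f (s, 1) = t s

/-- The horizontal path at height `s` in a square. -/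
def horizontal (f : C(I × I, Y)) (s : I) : Path (f (0, s)) (f (1, s)) where
  toFun t := f (t, s)
  continuous_toFun := by fun_prop
  source' := rfl
  target' := rfl

/-- The vertical path at abscissa `s` in a square. -/
def vertical (f : C(I × I, Y)) (s : I) : Path (f (s, 0)) (f (s, 1)) where
  toFun t := f (s, t)
  continuous_toFun := by fun_prop
  source' := rfl
  target' := rfl

/-- The two ways around the boundary are already homotopic in `I × I`, which is contractible and
hence simply connected; the homotopy is pushed forward along `f`. -/
theorem IsBoundary.homotopic {f : C(I × I, Y)} {x y z w : Y} {b : Path x y} {r : Path y w}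
    {l : Path x z} {t : Path z w} (h : IsBoundary f b r l t) :
    (b.trans r).Homotopic (l.trans t) := by
  obtain rfl : f (0, 0) = x := by rw [h.bottom, b.source]
  obtain rfl : f (1, 0) = y := by rw [h.bottom, b.target]
  obtain rfl : f (0, 1) = z := by rw [h.top, t.source]
  obtain rfl : f (1, 1) = w := by rw [h.top, t.target]
  have : ContractibleSpace I := (convex_Icc (0 : ℝ) 1).contractibleSpace ⟨0, by simp⟩
  have := (SimplyConnectedSpace.paths_homotopic
    ((horizontal (ContinuousMap.id (I × I)) 0).trans (vertical (ContinuousMap.id (I × I)) 1))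
    ((vertical (ContinuousMap.id (I × I)) 0).trans (horizontal (ContinuousMap.id (I × I)) 1))).map f
  rw [Path.map_trans, Path.map_trans] at this
  rwa [show b = (horizontal (.id _) 0).map f.continuous from Path.ext (funext fun s =>
      (h.bottom s).symm), show r = (vertical (.id _) 1).map f.continuous from
      Path.ext (funext fun s => (h.right s).symm), show l = (vertical (.id _) 0).map f.continuous
      from Path.ext (funext fun s => (h.left s).symm), show t = (horizontal (.id _) 1).map
      f.continuous from Path.ext (funext fun s => (h.top s).symm)]

/-- A property of squares that holds for all small squares with respect to an open covering and
is inherited from the four quadrants holds for all squares. -/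
theorem square_induction (hV : ∀ i, IsOpen (V i)) (hcov : ∀ y, ∃ i, y ∈ V i)
    {P : C(I × I, Y) → Prop} (small : ∀ (f : C(I × I, Y)) (i : ι), (∀ p, f p ∈ V i) → P f)
    (quadrants : ∀ f : C(I × I, Y), P (f.comp (lowerHalf.prodMap lowerHalf)) →
      P (f.comp (lowerHalf.prodMap upperHalf)) → P (f.comp (upperHalf.prodMap lowerHalf)) →
      P (f.comp (upperHalf.prodMap upperHalf)) → P f)
    (f : C(I × I, Y)) : P f := by
  have key (n : ℕ) : ∀ (f : C(I × I, Y)) (δ : ℝ), 1 < 2 ^ n * δ →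
      (∀ s, ∃ i, ∀ t, dist t s < δ → f t ∈ V i) → P f := by
    induction n with
    | zero =>
      intro f δ hδ h
      obtain ⟨i, hi⟩ := h 0
      refine small f i fun t => hi t (lt_of_le_of_lt ?_ (by simpa using hδ))
      rw [Prod.dist_eq, Subtype.dist_eq, Real.dist_eq, Subtype.dist_eq, Real.dist_eq]
      exact max_le (abs_le.mpr ⟨by simp; linarith [t.1.2.1], by simpa using t.1.2.2⟩)
        (abs_le.mpr ⟨by simp; linarith [t.2.2.1], by simpa using t.2.2.2⟩)
    | succ n ih =>
      intro f δ hδ h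
      rw [pow_succ, mul_assoc] at hδ
      have aux (a b : C(I, I)) (ha : ∀ s t, dist (a s) (a t) = dist s t / 2)
          (hb : ∀ s t, dist (b s) (b t) = dist s t / 2) : P (f.comp (a.prodMap b)) := by
        refine ih _ (2 * δ) hδ fun s => ?_
        obtain ⟨i, hi⟩ := h (a s.1, b s.2)
        refine ⟨i, fun t ht => hi _ ?_⟩
        rw [Prod.dist_eq] at ht ⊢
        have ht' := max_lt_iff.mp ht
        exact max_lt (by rw [ContinuousMap.prodMap_apply]; simp only [Prod.map]; rw [ha]; linarith [ht'.1])
          (by rw [ContinuousMap.prodMap_apply]; simp only [Prod.map]; rw [hb]; linarith [ht'.2])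
      exact quadrants f (aux _ _ dist_lowerHalf dist_lowerHalf)
        (aux _ _ dist_lowerHalf dist_upperHalf) (aux _ _ dist_upperHalf dist_lowerHalf)
        (aux _ _ dist_upperHalf dist_upperHalf)
  obtain ⟨δ, hδ, h⟩ := lebesgue_number_lemma_of_metric (c := fun i => f ⁻¹' V i) isCompact_univ
    (fun i => (hV i).preimage f.continuous) fun t _ => Set.mem_iUnion.mpr (hcov (f t))
  obtain ⟨n, hn⟩ := le_two_pow_mul hδ
  exact key n f δ hn fun s => (h s trivial).imp fun i hi t ht => hi ht

end Small

/-! ### Extending a transport from small paths to the fundamental groupoid. -/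

section LocalTransport

variable {Y : Type*} [TopologicalSpace Y] {ι : Type*}

/-- A transport with values in a category along the small paths with respect to a family of sets,
which is compatible with concatenation and invariant under homotopies inside a set of the
family. -/
structure LocalTransport (V : ι → Set Y) (D : Type*) [Category D] where
  obj : Y → D
  map {x y : Y} (γ : Path x y) (h : IsSmall V γ) : obj x ⟶ obj y
  map_refl (x : Y) (h : IsSmall V (Path.refl x)) : map (Path.refl x) h = 𝟙 (obj x)
  map_trans {x y z : Y} (γ : Path x y) (δ : Path y z) (h : IsSmall V (γ.trans δ)) :
    map (γ.trans δ) h = map γ h.left ≫ map δ h.right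
  map_square {x y z w : Y} {b : Path x y} {r : Path y w} {l : Path x z} {t : Path z w}
    {f : C(I × I, Y)} (hf : IsBoundary f b r l t) (i : ι) (hi : ∀ p, f p ∈ V i)
    (hb : IsSmall V b) (hr : IsSmall V r) (hl : IsSmall V l) (ht : IsSmall V t) :
    map b hb ≫ map r hr = map l hl ≫ map t ht

namespace LocalTransport

variable {V : ι → Set Y} {D : Type*} [Category D] (T : LocalTransport V D)

/-- The morphism `m` is the transport along `γ`, computed by cutting `γ` into `2 ^ n` small
pieces. -/
def Rel : ℕ → ∀ {x y : Y}, Path x y → (T.obj x ⟶ T.obj y) → Prop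
  | 0, _, _, γ, m => ∃ h, m = T.map γ h
  | n + 1, x, y, γ, m => ∃ (z : Y) (γ₁ : Path x z) (γ₂ : Path z y) (m₁ : T.obj x ⟶ T.obj z)
      (m₂ : T.obj z ⟶ T.obj y), γ = γ₁.trans γ₂ ∧ m = m₁ ≫ m₂ ∧ Rel n γ₁ m₁ ∧ Rel n γ₂ m₂

/-- By `trans_injective` the path determines its `2 ^ n` pieces, so the depth `n` is the only
freedom in computing a transport; `Rel.succ` and `Rel.mono` remove that freedom too. -/
theorem Rel.unique {n : ℕ} : ∀ {x y : Y} {γ : Path x y} {m m' : T.obj x ⟶ T.obj y},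
    T.Rel n γ m → T.Rel n γ m' → m = m' := by
  induction n with
  | zero =>
    rintro x y γ m m' ⟨h, rfl⟩ ⟨_, rfl⟩
    rfl
  | succ n ih =>
    rintro x y γ m m' ⟨z, γ₁, γ₂, m₁, m₂, rfl, rfl, h₁, h₂⟩ ⟨z', γ₁', γ₂', m₁', m₂', h, rfl, h₁', h₂'⟩
    obtain ⟨rfl, h, h'⟩ := trans_injective h
    obtain rfl := eq_of_heq h
    obtain rfl := eq_of_heq h'
    rw [ih h₁ h₁', ih h₂ h₂']

theorem Rel.succ {n : ℕ} : ∀ {x y : Y} {γ : Path x y} {m : T.obj x ⟶ T.obj y},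
    T.Rel n γ m → T.Rel (n + 1) γ m := by
  induction n with
  | zero =>
    rintro x y γ m ⟨h, rfl⟩
    obtain ⟨z, γ₁, γ₂, rfl⟩ : ∃ (z : Y) (γ₁ : Path x z) (γ₂ : Path z y), γ = γ₁.trans γ₂ :=
      ⟨_, _, _, (lowerPath_trans_upperPath γ).symm⟩
    exact ⟨_, _, _, _, _, rfl, T.map_trans _ _ h, ⟨_, rfl⟩, ⟨_, rfl⟩⟩
  | succ n ih =>
    rintro x y γ m ⟨z, γ₁, γ₂, m₁, m₂, rfl, rfl, h₁, h₂⟩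
    exact ⟨_, _, _, _, _, rfl, rfl, ih h₁, ih h₂⟩

theorem Rel.mono {n k : ℕ} (hnk : n ≤ k) {x y : Y} {γ : Path x y} {m : T.obj x ⟶ T.obj y}
    (h : T.Rel n γ m) : T.Rel k γ m := by
  induction hnk with
  | refl => exact h
  | step _ ih => exact ih.succ

theorem exists_rel (hV : ∀ i, IsOpen (V i)) (hcov : ∀ y, ∃ i, y ∈ V i) {x y : Y} (γ : Path x y) :
    ∃ m n, T.Rel n γ m := by
  refine path_induction (P := fun γ => ∃ m n, T.Rel n γ m) hV hcov
    (fun γ h => ⟨_, 0, h, rfl⟩) ?_ γ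
  rintro x y z γ δ ⟨m, n, h⟩ ⟨m', n', h'⟩
  exact ⟨m ≫ m', max n n' + 1, _, _, _, _, _, rfl, rfl, h.mono _ (le_max_left _ _),
    h'.mono _ (le_max_right _ _)⟩

variable (hV : ∀ i, IsOpen (V i)) (hcov : ∀ y, ∃ i, y ∈ V i)

/-- The transport along an arbitrary path. -/
noncomputable def transport {x y : Y} (γ : Path x y) : T.obj x ⟶ T.obj y :=
  (T.exists_rel hV hcov γ).choose

theorem transport_eq {n : ℕ} {x y : Y} {γ : Path x y} {m : T.obj x ⟶ T.obj y} (h : T.Rel n γ m) :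
    T.transport hV hcov γ = m :=
  have ⟨k, hk⟩ := (T.exists_rel hV hcov γ).choose_spec
  (hk.mono _ (le_max_right n k)).unique _ (h.mono _ (le_max_left n k))

theorem transport_of_isSmall {x y : Y} (γ : Path x y) (h : IsSmall V γ) :
    T.transport hV hcov γ = T.map γ h :=
  T.transport_eq hV hcov (n := 0) ⟨h, rfl⟩

theorem transport_trans {x y z : Y} (γ : Path x y) (δ : Path y z) :
    T.transport hV hcov (γ.trans δ) = T.transport hV hcov γ ≫ T.transport hV hcov δ := by
  obtain ⟨m, n, h⟩ := T.exists_rel hV hcov γ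
  obtain ⟨m', n', h'⟩ := T.exists_rel hV hcov δ
  rw [T.transport_eq hV hcov h, T.transport_eq hV hcov h']
  exact T.transport_eq hV hcov (n := max n n' + 1) ⟨_, _, _, _, _, rfl, rfl,
    h.mono _ (le_max_left _ _), h'.mono _ (le_max_right _ _)⟩

theorem transport_refl (x : Y) : T.transport hV hcov (Path.refl x) = 𝟙 (T.obj x) := by
  have h : IsSmall V (Path.refl x) := (hcov x).imp fun i hi _ => hi
  rw [T.transport_of_isSmall hV hcov _ h, T.map_refl]

theorem transport_square {x y z w : Y} {b : Path x y} {r : Path y w} {l : Path x z}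
    {t : Path z w} {f : C(I × I, Y)} (hf : IsBoundary f b r l t) :
    T.transport hV hcov b ≫ T.transport hV hcov r =
      T.transport hV hcov l ≫ T.transport hV hcov t := by
  revert x y z w
  refine square_induction (P := fun f => ∀ {x y z w : Y} {b : Path x y} {r : Path y w}
    {l : Path x z} {t : Path z w}, IsBoundary f b r l t → T.transport hV hcov b ≫
      T.transport hV hcov r = T.transport hV hcov l ≫ T.transport hV hcov t) hV hcov ?_ ?_ f
  · intro f i hi x y z w b r l t hf
    have hb : IsSmall V b := ⟨i, fun s => hf.bottom s ▸ hi _⟩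
    have hr : IsSmall V r := ⟨i, fun s => hf.right s ▸ hi _⟩
    have hl : IsSmall V l := ⟨i, fun s => hf.left s ▸ hi _⟩
    have ht : IsSmall V t := ⟨i, fun s => hf.top s ▸ hi _⟩
    rw [T.transport_of_isSmall hV hcov _ hb, T.transport_of_isSmall hV hcov _ hr,
      T.transport_of_isSmall hV hcov _ hl, T.transport_of_isSmall hV hcov _ ht]
    exact T.map_square hf i hi hb hr hl ht
  · intro f h₀₀ h₀₁ h₁₀ h₁₁ x y z w b r l t hf
    obtain ⟨y', b₁, b₂, rfl⟩ : ∃ (y' : Y) (b₁ : Path x y') (b₂ : Path y' y), b = b₁.trans b₂ :=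
      ⟨_, _, _, (lowerPath_trans_upperPath b).symm⟩
    obtain ⟨w', r₁, r₂, rfl⟩ : ∃ (w' : Y) (r₁ : Path y w') (r₂ : Path w' w), r = r₁.trans r₂ :=
      ⟨_, _, _, (lowerPath_trans_upperPath r).symm⟩
    obtain ⟨z', l₁, l₂, rfl⟩ : ∃ (z' : Y) (l₁ : Path x z') (l₂ : Path z' z), l = l₁.trans l₂ :=
      ⟨_, _, _, (lowerPath_trans_upperPath l).symm⟩
    obtain ⟨v, t₁, t₂, rfl⟩ : ∃ (v : Y) (t₁ : Path z v) (t₂ : Path v w), t = t₁.trans t₂ :=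
      ⟨_, _, _, (lowerPath_trans_upperPath t).symm⟩
    have eb₁ (s : I) : f (lowerHalf s, 0) = b₁ s := by rw [hf.bottom, trans_lowerHalf]
    have eb₂ (s : I) : f (upperHalf s, 0) = b₂ s := by rw [hf.bottom, trans_upperHalf]
    have er₁ (s : I) : f (1, lowerHalf s) = r₁ s := by rw [hf.right, trans_lowerHalf]
    have er₂ (s : I) : f (1, upperHalf s) = r₂ s := by rw [hf.right, trans_upperHalf]
    have el₁ (s : I) : f (0, lowerHalf s) = l₁ s := by rw [hf.left, trans_lowerHalf]
    have el₂ (s : I) : f (0, upperHalf s) = l₂ s := by rw [hf.left, trans_upperHalf]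
    have et₁ (s : I) : f (lowerHalf s, 1) = t₁ s := by rw [hf.top, trans_lowerHalf]
    have et₂ (s : I) : f (upperHalf s, 1) = t₂ s := by rw [hf.top, trans_upperHalf]
    -- `c` is the centre of the square, `p₁` and `p₂` form its horizontal midline, `q₁` and `q₂` its
    -- vertical one. Pasting the commutative squares of the four quadrants gives the outer square.
    let c := f (lowerHalf 1, lowerHalf 1)
    let p₁ : Path z' c :=
      { toFun s := f (lowerHalf s, lowerHalf 1)
        continuous_toFun := by fun_prop
        source' := by rw [lowerHalf_zero, el₁, l₁.target]
        target' := rfl }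
    let p₂ : Path c w' :=
      { toFun s := f (upperHalf s, lowerHalf 1)
        continuous_toFun := by fun_prop
        source' := by rw [upperHalf_zero]
        target' := by rw [upperHalf_one, er₁, r₁.target] }
    let q₁ : Path y' c :=
      { toFun s := f (lowerHalf 1, lowerHalf s)
        continuous_toFun := by fun_prop
        source' := by rw [lowerHalf_zero, eb₁, b₁.target]
        target' := rfl }
    let q₂ : Path c v :=
      { toFun s := f (lowerHalf 1, upperHalf s)
        continuous_toFun := by fun_prop
        source' := by rw [upperHalf_zero]
        target' := by rw [upperHalf_one, et₁, t₁.target] }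
    have e₀₀ := @h₀₀ _ _ _ _ b₁ q₁ l₁ p₁ ⟨fun s => by simp [eb₁], fun s => rfl,
      fun s => by simp [el₁], fun s => rfl⟩
    have e₁₀ := @h₁₀ _ _ _ _ b₂ r₁ q₁ p₂ ⟨fun s => by simp [eb₂], fun s => by simp [er₁],
      fun s => by simp [q₁], fun s => rfl⟩
    have e₀₁ := @h₀₁ _ _ _ _ p₁ q₂ l₂ t₁ ⟨fun s => by simp [p₁], fun s => rfl,
      fun s => by simp [el₂], fun s => by simp [et₁]⟩
    have e₁₁ := @h₁₁ _ _ _ _ p₂ r₂ q₂ t₂ ⟨fun s => by simp [p₂], fun s => by simp [er₂],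
      fun s => by simp [q₂], fun s => by simp [et₂]⟩
    simp only [transport_trans, Category.assoc]
    rw [reassoc_of% e₁₀, e₁₁, reassoc_of% e₀₀, reassoc_of% e₀₁]

/-- The functor on the fundamental groupoid defined by a local transport. -/
noncomputable def functor : FundamentalGroupoid Y ⥤ D where
  obj x := T.obj x.as
  map p := Quotient.lift (T.transport hV hcov) (by
    rintro γ δ ⟨H⟩
    -- A homotopy relative to the endpoints is a square with constant bottom and top, left side `γ`
    -- and right side `δ`.
    have h := T.transport_square hV hcov (b := Path.refl _) (r := δ) (l := γ) (t := Path.refl _)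
      (f := H.toContinuousMap) ⟨by simp, by simp, by simp, by simp⟩
    simpa [transport_refl] using h.symm) p
  map_id x := T.transport_refl hV hcov x.as
  map_comp := by
    rintro x y z ⟨γ⟩ ⟨δ⟩
    exact T.transport_trans hV hcov γ δ

theorem functor_map_of_isSmall {x y : FundamentalGroupoid Y} (γ : Path x.as y.as)
    (h : IsSmall V γ) :
    (T.functor hV hcov).map (Path.Homotopic.Quotient.mk γ : x ⟶ y) = T.map γ h :=
  T.transport_of_isSmall hV hcov γ h

end LocalTransport

end LocalTransport

/-! ### The van Kampen theorem: `U ↦ Π₁(U)` is a costack. -/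

section FundamentalGroupoid

variable {X : Type u} [TopologicalSpace X]

/-- A point of an open subset, as an object of the fundamental groupoid. -/
def point (U : Opens X) (x : X) (hx : x ∈ U) : FundamentalGroupoid U :=
  ⟨⟨x, hx⟩⟩

/-- A path contained in an open subset, as a path of this subset. -/
def restrictPath {W : Opens X} (U : Opens X) {x y : W} (γ : Path x y) (h : ∀ t, (γ t).1 ∈ U) :
    Path (⟨x.1, by simpa using h 0⟩ : U) ⟨y.1, by simpa using h 1⟩ where
  toFun t := ⟨(γ t).1, h t⟩
  continuous_toFun := by fun_prop
  source' := by simp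
  target' := by simp

/-- The class of a path contained in an open subset, as a morphism of the fundamental groupoid. -/
def pathClass {W : Opens X} (U : Opens X) {x y : W} (γ : Path x y) (h : ∀ t, (γ t).1 ∈ U) :
    point U x.1 (by simpa using h 0) ⟶ point U y.1 (by simpa using h 1) :=
  Path.Homotopic.Quotient.mk (restrictPath U γ h)

theorem restrictPath_trans {W : Opens X} (U : Opens X) {x y z : W} (γ : Path x y) (δ : Path y z)
    (h : ∀ t, (γ.trans δ t).1 ∈ U) (h₁ : ∀ t, (γ t).1 ∈ U) (h₂ : ∀ t, (δ t).1 ∈ U) :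
    restrictPath U (γ.trans δ) h = (restrictPath U γ h₁).trans (restrictPath U δ h₂) :=
  eq_trans_of_halves (fun t => Subtype.ext (by simp [restrictPath]))
    (fun t => Subtype.ext (by simp [restrictPath]))

theorem pathClass_trans {W : Opens X} (U : Opens X) {x y z : W} (γ : Path x y) (δ : Path y z)
    (h : ∀ t, (γ.trans δ t).1 ∈ U) (h₁ : ∀ t, (γ t).1 ∈ U) (h₂ : ∀ t, (δ t).1 ∈ U) :
    pathClass U (γ.trans δ) h = pathClass U γ h₁ ≫ pathClass U δ h₂ :=
  congrArg Path.Homotopic.Quotient.mk (restrictPath_trans U γ δ h h₁ h₂)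

theorem pathClass_square {W : Opens X} (U : Opens X) {x y z w : W} {b : Path x y}
    {r : Path y w} {l : Path x z} {t : Path z w} {f : C(I × I, W)} (hf : IsBoundary f b r l t)
    (h : ∀ p, (f p).1 ∈ U) :
    pathClass U b (fun s => hf.bottom s ▸ h _) ≫ pathClass U r (fun s => hf.right s ▸ h _) =
      pathClass U l (fun s => hf.left s ▸ h _) ≫ pathClass U t (fun s => hf.top s ▸ h _) :=
  Quotient.sound (IsBoundary.homotopic (f := ⟨fun p => (⟨(f p).1, h p⟩ : U), by fun_prop⟩)
    ⟨fun s => Subtype.ext (congrArg (fun y : W => y.1) (hf.bottom s)),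
      fun s => Subtype.ext (congrArg (fun y : W => y.1) (hf.right s)),
      fun s => Subtype.ext (congrArg (fun y : W => y.1) (hf.left s)),
      fun s => Subtype.ext (congrArg (fun y : W => y.1) (hf.top s))⟩)

/-- Π₁ comes from a strict functor, so its coherence isomorphisms are `eqToHom`s. Their components
are identities because both composites of inclusions send a point to the same point definitionally.
-/
theorem fundamentalGroupoid_pushComp_hom_app {W V U : Opens X} (h₁ : W ≤ V) (h₂ : V ≤ U)
    (x : (fundamentalGroupoid X).val W) :
    ((fundamentalGroupoid X).pushComp h₁ h₂).hom.app x =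
      𝟙 (((fundamentalGroupoid X).push (h₁.trans h₂)).obj x) :=
  eqToHom_app (show (fundamentalGroupoid X).push (h₁.trans h₂) =
    (fundamentalGroupoid X).push h₁ ⋙ (fundamentalGroupoid X).push h₂ from
    Functor.map_comp (Opens.toTopCat (TopCat.of X) ⋙
      FundamentalGroupoid.fundamentalGroupoidFunctor) (homOfLE h₁) (homOfLE h₂)) x

theorem fundamentalGroupoid_pushComp_inv_app {W V U : Opens X} (h₁ : W ≤ V) (h₂ : V ≤ U)
    (x : (fundamentalGroupoid X).val W) :
    ((fundamentalGroupoid X).pushComp h₁ h₂).inv.app x =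
      𝟙 (((fundamentalGroupoid X).push (h₁.trans h₂)).obj x) :=
  eqToHom_app (show (fundamentalGroupoid X).push h₁ ⋙ (fundamentalGroupoid X).push h₂ =
    (fundamentalGroupoid X).push (h₁.trans h₂) from
    (Functor.map_comp (Opens.toTopCat (TopCat.of X) ⋙
      FundamentalGroupoid.fundamentalGroupoidFunctor) (homOfLE h₁) (homOfLE h₂)).symm) x

variable {ι : Type*} {U : ι → Opens X} {D : Type*} [Category D]

/-- The covering of a union of open subsets by these open subsets. -/
def coverSet (U : ι → Opens X) (i : ι) : Set (⨆ i, U i : Opens X) := {x | x.1 ∈ U i}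

theorem isOpen_coverSet (U : ι → Opens X) (i : ι) : IsOpen (coverSet U i) :=
  (U i).isOpen.preimage continuous_subtype_val

theorem exists_mem_coverSet (U : ι → Opens X) (x : (⨆ i, U i : Opens X)) : ∃ i, x ∈ coverSet U i :=
  Opens.mem_iSup.mp x.2


/-- Functors on the fundamental groupoids of the members of a family of open subsets, together with
isomorphisms at the points of double intersections, which are natural with respect to paths and
satisfy the cocycle condition. -/
structure PathCocone (U : ι → Opens X) (D : Type*) [Category D] where
  obj (i : ι) : FundamentalGroupoid (U i) ⥤ D
  hom (i j : ι) (x : X) (hi : x ∈ U i) (hj : x ∈ U j) :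
    (obj i).obj (point (U i) x hi) ⟶ (obj j).obj (point (U j) x hj)
  hom_self (i : ι) (x : X) (hi : x ∈ U i) : hom i i x hi hi = 𝟙 _
  hom_comp (i j k : ι) (x : X) (hi : x ∈ U i) (hj : x ∈ U j) (hk : x ∈ U k) :
    hom i j x hi hj ≫ hom j k x hj hk = hom i k x hi hk
  naturality (i j : ι) {W : Opens X} {x y : W} (γ : Path x y) (hi : ∀ t, (γ t).1 ∈ U i)
    (hj : ∀ t, (γ t).1 ∈ U j) :
    (obj i).map (pathClass (U i) γ hi) ≫
        hom i j y.1 (by simpa using hi 1) (by simpa using hj 1) =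
      hom i j x.1 (by simpa using hi 0) (by simpa using hj 0) ≫
        (obj j).map (pathClass (U j) γ hj)

/-- A member of the covering that contains a given point. -/
noncomputable def index (U : ι → Opens X) (x : (⨆ i, U i : Opens X)) : ι :=
  (exists_mem_coverSet U x).choose

theorem mem_index (x : (⨆ i, U i : Opens X)) : x.1 ∈ U (index U x) :=
  (exists_mem_coverSet U x).choose_spec

namespace PathCocone

variable (A : PathCocone U D)

/-- The transport along a path contained in a member of the covering, defined by a cocone. -/
noncomputable def smallTransport (i : ι) {x y : (⨆ i, U i : Opens X)} (γ : Path x y)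
    (h : ∀ t, (γ t).1 ∈ U i) :
    (A.obj (index U x)).obj (point _ x.1 (mem_index x)) ⟶
      (A.obj (index U y)).obj (point _ y.1 (mem_index y)) :=
  A.hom (index U x) i x.1 (mem_index x) (by simpa using h 0) ≫
    (A.obj i).map (pathClass (U i) γ h) ≫
    A.hom i (index U y) y.1 (by simpa using h 1) (mem_index y)

/-- The path lies in `U i ∩ U j`, where naturality of the gluing isomorphisms compares the two
functors; the cocycle condition absorbs the difference at the endpoints. This makes the index chosen
in `localTransport` immaterial. -/
theorem smallTransport_eq (i j : ι) {x y : (⨆ i, U i : Opens X)} (γ : Path x y)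
    (hi : ∀ t, (γ t).1 ∈ U i) (hj : ∀ t, (γ t).1 ∈ U j) :
    A.smallTransport i γ hi = A.smallTransport j γ hj := by
  unfold smallTransport
  rw [← A.hom_comp (index U x) i j x.1 (mem_index x) (by simpa using hi 0)
    (by simpa using hj 0), Category.assoc, ← reassoc_of% (A.naturality i j γ hi hj),
    hom_comp]

theorem smallTransport_comp_hom (i : ι) {x y : (⨆ i, U i : Opens X)} (γ : Path x y)
    (h : ∀ t, (γ t).1 ∈ U i) :
    A.smallTransport i γ h ≫ A.hom (index U y) i y.1 (mem_index y) (by simpa using h 1) =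
      A.hom (index U x) i x.1 (mem_index x) (by simpa using h 0) ≫
        (A.obj i).map (pathClass (U i) γ h) := by
  unfold smallTransport
  rw [Category.assoc, Category.assoc, hom_comp, hom_self, Category.comp_id]

/-- The transport along small paths defined by a cocone under the fundamental groupoids. -/
noncomputable def localTransport : LocalTransport (coverSet U) D where
  obj x := (A.obj (index U x)).obj (point _ x.1 (mem_index x))
  map γ h := A.smallTransport h.choose γ h.choose_spec
  map_refl x h := by
    unfold smallTransport
    rw [show pathClass (U h.choose) (Path.refl x) h.choose_spec = 𝟙 _ from rfl,
      CategoryTheory.Functor.map_id, Category.id_comp, hom_comp, hom_self]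
  map_trans {x y z} γ δ h := by
    obtain ⟨i, hi⟩ := id h
    have h₁ : ∀ t, (γ t).1 ∈ U i := fun t => trans_lowerHalf γ δ t ▸ hi _
    have h₂ : ∀ t, (δ t).1 ∈ U i := fun t => trans_upperHalf γ δ t ▸ hi _
    rw [A.smallTransport_eq _ i (γ.trans δ) h.choose_spec hi,
      A.smallTransport_eq _ i γ h.left.choose_spec h₁,
      A.smallTransport_eq _ i δ h.right.choose_spec h₂]
    unfold smallTransport
    rw [pathClass_trans _ _ _ hi h₁ h₂, Functor.map_comp]
    simp only [Category.assoc]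
    rw [reassoc_of% A.hom_comp i (index U y) i, hom_self, Category.id_comp]
  map_square {x y z w b r l t f} hf i hi hb hr hl ht := by
    have hb' : ∀ s, (b s).1 ∈ U i := fun s => hf.bottom s ▸ hi _
    have hr' : ∀ s, (r s).1 ∈ U i := fun s => hf.right s ▸ hi _
    have hl' : ∀ s, (l s).1 ∈ U i := fun s => hf.left s ▸ hi _
    have ht' : ∀ s, (t s).1 ∈ U i := fun s => hf.top s ▸ hi _
    rw [A.smallTransport_eq _ i b hb.choose_spec hb', A.smallTransport_eq _ i r hr.choose_spec hr',
      A.smallTransport_eq _ i l hl.choose_spec hl', A.smallTransport_eq _ i t ht.choose_spec ht']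
    unfold smallTransport
    simp only [Category.assoc]
    rw [reassoc_of% A.hom_comp i (index U y) i, reassoc_of% A.hom_comp i (index U z) i,
      hom_self, hom_self, Category.id_comp, Category.id_comp,
      ← Functor.map_comp_assoc, ← Functor.map_comp_assoc, pathClass_square (U i) hf hi]

/-- The functor on the fundamental groupoid of a union defined by a cocone. -/
noncomputable def desc : FundamentalGroupoid (⨆ i, U i : Opens X) ⥤ D :=
  A.localTransport.functor (isOpen_coverSet U) (exists_mem_coverSet U)

theorem desc_map_pathClass (i : ι) {x y : (⨆ i, U i : Opens X)} (γ : Path x y)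
    (h : ∀ t, (γ t).1 ∈ U i) :
    A.desc.map (X := ⟨x⟩) (Y := ⟨y⟩) (Path.Homotopic.Quotient.mk γ) = A.smallTransport i γ h :=
  (A.localTransport.functor_map_of_isSmall (isOpen_coverSet U) (exists_mem_coverSet U)
    (x := ⟨x⟩) (y := ⟨y⟩) γ ⟨i, h⟩).trans (A.smallTransport_eq _ i _ _ h)

/-- The restriction of the functor defined by a cocone to a member of the covering. -/
noncomputable def descIso (i : ι) :
    FundamentalGroupoid.map ⟨Set.inclusion (le_iSup U i), continuous_inclusion _⟩ ⋙ A.desc ≅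
      A.obj i :=
  NatIso.ofComponents
    (fun x =>
      { hom := A.hom (index U ⟨x.as.1, le_iSup U i x.as.2⟩) i x.as.1 (mem_index _) x.as.2
        inv := A.hom i (index U ⟨x.as.1, le_iSup U i x.as.2⟩) x.as.1 x.as.2 (mem_index _)
        hom_inv_id := (A.hom_comp _ _ _ _ _ _ _).trans (A.hom_self _ _ _)
        inv_hom_id := (A.hom_comp _ _ _ _ _ _ _).trans (A.hom_self _ _ _) }) (by
    rintro ⟨x⟩ ⟨y⟩ ⟨γ⟩
    exact (congrArg (· ≫ _) (A.desc_map_pathClass i (γ.map (continuous_inclusion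
      (le_iSup U i))) (fun t => (γ t).2))).trans (A.smallTransport_comp_hom i _ _))

end PathCocone


/-- A family of morphisms which is natural with respect to small paths is natural. -/
def natTransOfIsSmall {Y : Type*} [TopologicalSpace Y] {V : ι → Set Y} (hV : ∀ i, IsOpen (V i))
    (hcov : ∀ y, ∃ i, y ∈ V i) {G H : FundamentalGroupoid Y ⥤ D} (g : ∀ x, G.obj x ⟶ H.obj x)
    (hg : ∀ {x y : Y} (γ : Path x y), IsSmall V γ →
      G.map (X := ⟨x⟩) (Y := ⟨y⟩) (Path.Homotopic.Quotient.mk γ) ≫ g ⟨y⟩ =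
        g ⟨x⟩ ≫ H.map (X := ⟨x⟩) (Y := ⟨y⟩) (Path.Homotopic.Quotient.mk γ)) : G ⟶ H where
  app := g
  naturality := by
    rintro ⟨x⟩ ⟨y⟩ ⟨γ⟩
    refine path_induction (P := fun {x y} γ => G.map (X := ⟨x⟩) (Y := ⟨y⟩)
        (Path.Homotopic.Quotient.mk γ) ≫ g ⟨y⟩ = g ⟨x⟩ ≫ H.map (X := ⟨x⟩) (Y := ⟨y⟩)
        (Path.Homotopic.Quotient.mk γ)) hV hcov hg (fun {x y z} γ δ h₁ h₂ => ?_) γ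
    have hG := G.map_comp (X := ⟨x⟩) (Y := ⟨y⟩) (Z := ⟨z⟩) (Path.Homotopic.Quotient.mk γ)
      (Path.Homotopic.Quotient.mk δ)
    have hH := H.map_comp (X := ⟨x⟩) (Y := ⟨y⟩) (Z := ⟨z⟩) (Path.Homotopic.Quotient.mk γ)
      (Path.Homotopic.Quotient.mk δ)
    refine (congrArg (· ≫ _) hG).trans (Eq.trans ?_ (congrArg (_ ≫ ·) hH).symm)
    rw [Category.assoc, h₂, reassoc_of% h₁]

theorem map_comp_comp_map_of_eq_id {C C' D : Type*} [Category C] [Category C'] [Category D]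
    (F : C ⥤ D) (G : C' ⥤ D) {x : C} {y : C'} {f : x ⟶ x} {g : y ⟶ y} (hf : f = 𝟙 x)
    (hg : g = 𝟙 y) (h : F.obj x ⟶ G.obj y) : F.map f ≫ h ≫ G.map g = h := by
  rw [hf, hg, CategoryTheory.Functor.map_id, CategoryTheory.Functor.map_id, Category.id_comp,
    Category.comp_id]

theorem iso_inv_comm {C : Type*} [Category C] {a b a' b' : C} (e : a ≅ b) (e' : a' ≅ b')
    {f : a ⟶ a'} {g : b ⟶ b'} (h : e.hom ≫ g = f ≫ e'.hom) : e.inv ≫ f = g ≫ e'.inv := by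
  rw [Iso.inv_comp_eq, ← Category.assoc, Iso.eq_comp_inv, h]

section

variable {ι : Type u} {U : ι → Opens X} {D : Grpd.{u, u}}

theorem restrictIso_fundamentalGroupoid (G : (fundamentalGroupoid X).val (⨆ i, U i) ⥤ D)
    (i j : ι) (x : (fundamentalGroupoid X).val (U i ⊓ U j)) :
    (restrictIso (fundamentalGroupoid X) U G i j).hom.app x = 𝟙 _ :=
  (congrArg G.map ((congrArg₂ (· ≫ ·)
    (fundamentalGroupoid_pushComp_inv_app (inf_le_left : U i ⊓ U j ≤ U i) (le_iSup U i) x)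
    (fundamentalGroupoid_pushComp_hom_app (inf_le_right : U i ⊓ U j ≤ U j) (le_iSup U j) x)).trans
    (Category.id_comp _))).trans (G.map_id _)

theorem restrictHom_fundamentalGroupoid (A : Cocone (fundamentalGroupoid X) U D) {i j : ι}
    {W : Opens X} (hi : W ≤ U i) (hj : W ≤ U j) (x : X) (hx : x ∈ W) :
    restrictHom (fundamentalGroupoid X) A.obj A.iso hi hj (point W x hx) =
      (A.iso i j).hom.app (point (U i ⊓ U j) x ⟨hi hx, hj hx⟩) := by
  exact map_comp_comp_map_of_eq_id (A.obj i) (A.obj j)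
    (fundamentalGroupoid_pushComp_hom_app (le_inf hi hj) inf_le_left (point W x hx))
    (fundamentalGroupoid_pushComp_inv_app (le_inf hi hj) inf_le_right (point W x hx)) _

/-- A cocone under the fundamental groupoids in terms of points and paths. -/
def Cocone.toPathCocone (A : Cocone (fundamentalGroupoid X) U D) : PathCocone U D :=
  have hom_comp (i j k : ι) (x : X) (hi : x ∈ U i) (hj : x ∈ U j) (hk : x ∈ U k) :
      (A.iso i j).hom.app (point (U i ⊓ U j) x ⟨hi, hj⟩) ≫
        (A.iso j k).hom.app (point (U j ⊓ U k) x ⟨hj, hk⟩) =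
      (A.iso i k).hom.app (point (U i ⊓ U k) x ⟨hi, hk⟩) := by
    have h := A.cocycle i j k (point (U i ⊓ U j ⊓ U k) x ⟨⟨hi, hj⟩, hk⟩)
    have h₁ := restrictHom_fundamentalGroupoid A (W := U i ⊓ U j ⊓ U k)
      (inf_le_left.trans inf_le_left) (inf_le_left.trans inf_le_right) x ⟨⟨hi, hj⟩, hk⟩
    have h₂ := restrictHom_fundamentalGroupoid A (W := U i ⊓ U j ⊓ U k)
      (inf_le_left.trans inf_le_right) inf_le_right x ⟨⟨hi, hj⟩, hk⟩
    have h₃ := restrictHom_fundamentalGroupoid A (W := U i ⊓ U j ⊓ U k)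
      (inf_le_left.trans inf_le_left) inf_le_right x ⟨⟨hi, hj⟩, hk⟩
    exact (congrArg₂ (· ≫ ·) h₁ h₂).symm.trans (h.trans h₃)
  { obj := A.obj
    hom i j x hi hj := (A.iso i j).hom.app (point (U i ⊓ U j) x ⟨hi, hj⟩)
    -- The cocycle condition with all indices equal makes this isomorphism idempotent, hence an
    -- identity.
    hom_self i x hi :=
      (cancel_epi ((A.iso i i).hom.app (point (U i ⊓ U i) x ⟨hi, hi⟩))).mp
        ((hom_comp i i i x hi hi hi).trans (Category.comp_id _).symm)
    hom_comp := hom_comp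
    naturality i j _ _ _ γ hi hj :=
      (A.iso i j).hom.naturality (pathClass (U i ⊓ U j) γ fun t => ⟨hi t, hj t⟩) }

/-- Every object of `Π₁(⋃ U i)` is a point of some `U i`, so the restrictions contain all
components. -/
theorem fundamentalGroupoid_toCocone_faithful :
    (toCocone (fundamentalGroupoid X) U D).Faithful where
  map_injective {G H α β} h := by
    apply NatTrans.ext
    funext ⟨x⟩
    obtain ⟨i, hi⟩ := exists_mem_coverSet U x
    exact congrArg (fun f => NatTrans.app (Cocone.Hom.app f i) (point (U i) x.1 hi)) h

/-- The restriction isomorphisms of Π₁ are identities, so compatibility on double intersections says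
that the components at a common point are equal. Naturality need only be tested on small paths,
which lie in one `U i`. -/
theorem fundamentalGroupoid_toCocone_full : (toCocone (fundamentalGroupoid X) U D).Full where
  map_surjective {G H} f := by
    have happ (i j : ι) (x : X) (hi : x ∈ U i) (hj : x ∈ U j) :
        (f.app i).app (point (U i) x hi) = (f.app j).app (point (U j) x hj) := by
      have h := NatTrans.congr_app (f.comm i j) (point (U i ⊓ U j) x ⟨hi, hj⟩)
      exact ((Category.comp_id _).symm.trans ((congrArg (_ ≫ ·)
        (restrictIso_fundamentalGroupoid H i j _)).symm.trans (h.trans ((congrArg (· ≫ _)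
        (restrictIso_fundamentalGroupoid G i j _)).trans (Category.id_comp _)))))
    have hg {x y : (⨆ i, U i : Opens X)} (γ : Path x y) (h : IsSmall (coverSet U) γ) :
        G.map (X := ⟨x⟩) (Y := ⟨y⟩) (Path.Homotopic.Quotient.mk γ) ≫
            (f.app (index U y)).app (point (U (index U y)) y.1 (mem_index y)) =
          (f.app (index U x)).app (point (U (index U x)) x.1 (mem_index x)) ≫
            H.map (X := ⟨x⟩) (Y := ⟨y⟩) (Path.Homotopic.Quotient.mk γ) := by
      obtain ⟨i, hi⟩ := h
      have hx : x.1 ∈ U i := γ.source ▸ hi 0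
      have hy : y.1 ∈ U i := γ.target ▸ hi 1
      exact (congrArg (_ ≫ ·) (happ _ _ _ (mem_index y) hy)).trans
        (((f.app i).naturality (pathClass (U i) γ hi)).trans
          (congrArg (· ≫ _) (happ _ _ _ (mem_index x) hx)).symm)
    refine ⟨natTransOfIsSmall (isOpen_coverSet U) (exists_mem_coverSet U) (fun x =>
      (f.app (index U x.as)).app (point (U (index U x.as)) x.as.1 (mem_index x.as))) hg, ?_⟩
    apply Cocone.Hom.ext
    funext i
    apply NatTrans.ext
    funext ⟨x⟩
    exact happ _ _ _ _ x.2

/-- The preimage is `PathCocone.desc`. Compatibility of the isomorphisms `descIso` with those of the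
cocone is the cocycle condition for `index`, `i` and `j`. -/
theorem fundamentalGroupoid_toCocone_essSurj :
    (toCocone (fundamentalGroupoid X) U D).EssSurj where
  mem_essImage A := by
    have hcomm (i j : ι) : Functor.whiskerLeft ((fundamentalGroupoid X).push inf_le_left)
        (A.toPathCocone.descIso i).hom ≫ (A.iso i j).hom =
        (restrictIso (fundamentalGroupoid X) U A.toPathCocone.desc i j).hom ≫
          Functor.whiskerLeft ((fundamentalGroupoid X).push inf_le_right)
            (A.toPathCocone.descIso j).hom := by
      apply NatTrans.ext
      funext ⟨x⟩
      exact (A.toPathCocone.hom_comp _ _ _ _ (mem_index _) x.2.1 x.2.2).trans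
        ((Category.id_comp _).symm.trans
          (congrArg (· ≫ (A.toPathCocone.descIso j).hom.app
            (((fundamentalGroupoid X).push inf_le_right).obj ⟨x⟩))
            (restrictIso_fundamentalGroupoid A.toPathCocone.desc i j ⟨x⟩)).symm)
    refine ⟨A.toPathCocone.desc, ⟨⟨⟨fun i => (A.toPathCocone.descIso i).hom, hcomm⟩,
      ⟨fun i => (A.toPathCocone.descIso i).inv, fun i j => ?_⟩, ?_, ?_⟩⟩⟩
    · exact iso_inv_comm
        (Functor.isoWhiskerLeft ((fundamentalGroupoid X).push inf_le_left)
          (A.toPathCocone.descIso i))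
        (Functor.isoWhiskerLeft ((fundamentalGroupoid X).push inf_le_right)
          (A.toPathCocone.descIso j)) (hcomm i j)
    · exact Cocone.Hom.ext (funext fun i => (A.toPathCocone.descIso i).hom_inv_id)
    · exact Cocone.Hom.ext (funext fun i => (A.toPathCocone.descIso i).inv_hom_id)

variable (X) in
/-- The fundamental groupoid satisfies the van Kampen theorem for arbitrary open coverings. -/
theorem isCostack_fundamentalGroupoid : IsCostack (fundamentalGroupoid X) := fun _ _ _ =>
  { faithful := fundamentalGroupoid_toCocone_faithful
    full := fundamentalGroupoid_toCocone_full
    essSurj := fundamentalGroupoid_toCocone_essSurj }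

end

end FundamentalGroupoid

/-! ### Unit coherence of 2-functors. -/

namespace OpenFunctor

variable {X : Type u} [TopologicalSpace X] (F : OpenFunctor X)

/-- The coherence isomorphism between `F(U) ⥤ F(U)` and the identity. -/
def pushId (U : Opens X) : F.push (le_refl U) ≅ 𝟭 (F.val U) := F.mapId ⟨U⟩

theorem pushComp_refl_left {V U : Opens X} (h : V ≤ U) (x : F.val V) :
    (F.pushComp le_rfl h).hom.app x = (F.push h).map ((F.pushId V).inv.app x) := by
  have e := F.mapComp_id_left_hom (homOfLE h).toLoc
  rw [show F.map₂ (λ_ (homOfLE h).toLoc).hom = 𝟙 _ from F.map₂_id _] at e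
  exact (congrArg (fun t => NatTrans.app t x) e).trans
    ((Category.id_comp _).trans (Category.id_comp _))

theorem pushComp_refl_right {V U : Opens X} (h : V ≤ U) (x : F.val V) :
    (F.pushComp h le_rfl).hom.app x = (F.pushId U).inv.app ((F.push h).obj x) := by
  have e := F.mapComp_id_right_hom (homOfLE h).toLoc
  rw [show F.map₂ (ρ_ (homOfLE h).toLoc).hom = 𝟙 _ from F.map₂_id _] at e
  exact (congrArg (fun t => NatTrans.app t x) e).trans
    ((Category.id_comp _).trans (Category.id_comp _))

end OpenFunctor

/-! ### Gluing functors and natural transformations on a costack from a base. -/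

section Gluing

variable {X : Type u} [TopologicalSpace X]

/-- The members of a family of open subsets that are contained in a given open subset. -/
abbrev Members (B : Set (Opens X)) (U : Opens X) : Type u := {S : Opens X // S ∈ B ∧ S ≤ U}

/-- Every open subset is the union of the members of `B` contained in it. -/
def IsBase (B : Set (Opens X)) : Prop := ∀ U : Opens X, ⨆ S : Members B U, S.1 = U

namespace Members

variable {B : Set (Opens X)} {W U : Opens X}

/-- A member of `B` in a smaller open subset is also contained in a larger one. -/
abbrev ofLE (h : W ≤ U) (S : Members B W) : Members B U := ⟨S.1, S.2.1, S.2.2.trans h⟩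

end Members

variable {Q : OpenFunctor X} {B : Set (Opens X)} {U : Opens X} {D : Grpd.{u, u}}

/-- This and the next two lemmas unfold faithfulness, fullness and essential surjectivity of
`toCocone`, for an open set that is only propositionally equal to the union, as `IsBase` provides.
-/
theorem IsCostack.hom_ext_of_iSup_eq (hQ : IsCostack Q) {ι : Type u} {V : ι → Opens X}
    (hV : ⨆ i, V i = U) {G H : Q.val U ⥤ D} {α β : G ⟶ H}
    (h : ∀ i (hi : V i ≤ U) (x : Q.val (V i)),
      α.app ((Q.push hi).obj x) = β.app ((Q.push hi).obj x)) : α = β := by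
  subst hV
  have := hQ ι V D
  apply (toCocone Q V D).map_injective
  apply Cocone.Hom.ext
  funext i
  apply NatTrans.ext
  funext x
  exact h i _ x

theorem IsCostack.exists_hom_of_iSup_eq (hQ : IsCostack Q) {ι : Type u} {V : ι → Opens X}
    (hV : ⨆ i, V i = U) (hle : ∀ i, V i ≤ U) {G H : Q.val U ⥤ D}
    (α : ∀ i, Q.push (hle i) ⋙ G ⟶ Q.push (hle i) ⋙ H)
    (comm : ∀ i j (x : Q.val (V i ⊓ V j)),
      (α i).app ((Q.push inf_le_left).obj x) ≫
        H.map ((Q.pushComp inf_le_left (hle i)).inv.app x ≫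
          (Q.pushComp inf_le_right (hle j)).hom.app x) =
      G.map ((Q.pushComp inf_le_left (hle i)).inv.app x ≫
          (Q.pushComp inf_le_right (hle j)).hom.app x) ≫
        (α j).app ((Q.push inf_le_right).obj x)) :
    ∃ γ : G ⟶ H, ∀ i x, γ.app ((Q.push (hle i)).obj x) = (α i).app x := by
  subst hV
  have := hQ ι V D
  obtain ⟨γ, hγ⟩ := (toCocone Q V D).map_surjective (X := G) (Y := H)
    ⟨α, fun i j => NatTrans.ext (funext fun x => comm i j x)⟩
  exact ⟨γ, fun i x => congrArg (fun f => NatTrans.app (Cocone.Hom.app f i) x) hγ⟩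

theorem IsCostack.exists_functor_of_iSup_eq (hQ : IsCostack Q) {ι : Type u} {V : ι → Opens X}
    (hV : ⨆ i, V i = U) (hle : ∀ i, V i ≤ U) (A : Cocone Q V D) :
    ∃ (G : Q.val U ⥤ D) (φ : ∀ i, Q.push (hle i) ⋙ G ⟶ A.obj i),
      ∀ i j (x : Q.val (V i ⊓ V j)),
        (φ i).app ((Q.push inf_le_left).obj x) ≫ (A.iso i j).hom.app x =
          G.map ((Q.pushComp inf_le_left (hle i)).inv.app x ≫
            (Q.pushComp inf_le_right (hle j)).hom.app x) ≫
          (φ j).app ((Q.push inf_le_right).obj x) := by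
  subst hV
  have := hQ ι V D
  let e := (toCocone Q V D).objObjPreimageIso A
  exact ⟨(toCocone Q V D).objPreimage A, e.hom.app,
    fun i j x => NatTrans.congr_app (e.hom.comm i j) x⟩

theorem IsCostack.hom_ext (hQ : IsCostack Q) (hB : IsBase B) {G H : Q.val U ⥤ D} {α β : G ⟶ H}
    (h : ∀ (S : Members B U) (x : Q.val S.1),
      α.app ((Q.push S.2.2).obj x) = β.app ((Q.push S.2.2).obj x)) : α = β :=
  hQ.hom_ext_of_iSup_eq (hB U) fun S _ x => h S x

/-- The chase behind `IsCostack.exists_hom`: compatibility along `T ⊆ S` and `T ⊆ S'` yields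
compatibility over `S ∩ S'` at objects coming from `T`. The hypotheses `h` and `h'` are the
associativity coherences. -/
theorem comp_map_eq_of_conj {C D : Type*} [Category C] [Category D] {G H : C ⥤ D}
    {a b c w b' c' : C} {A : a ⟶ b} {m : b ⟶ c} {E : a ⟶ w} {P : w ≅ c} {A' : a ⟶ b'}
    {m' : b' ⟶ c'} {P' : w ⟶ c'} [IsIso E] {αa : G.obj a ⟶ H.obj a} {αb : G.obj b ⟶ H.obj b}
    {αb' : G.obj b' ⟶ H.obj b'} {αc : G.obj c ⟶ H.obj c} {αc' : G.obj c' ⟶ H.obj c'}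
    (h : A ≫ m = E ≫ P.hom) (h' : A' ≫ m' = E ≫ P')
    (hA : αa ≫ H.map A = G.map A ≫ αb) (hA' : αa ≫ H.map A' = G.map A' ≫ αb')
    (hm : G.map m ≫ αc = αb ≫ H.map m) (hm' : G.map m' ≫ αc' = αb' ≫ H.map m') :
    αc ≫ H.map (P.inv ≫ P') = G.map (P.inv ≫ P') ≫ αc' := by
  have e : G.map (E ≫ P.hom) ≫ αc = αa ≫ H.map (E ≫ P.hom) := by
    rw [← h, G.map_comp, H.map_comp, Category.assoc, hm, ← Category.assoc, ← hA, Category.assoc]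
  have e' : G.map (E ≫ P') ≫ αc' = αa ≫ H.map (E ≫ P') := by
    rw [← h', G.map_comp, H.map_comp, Category.assoc, hm', ← Category.assoc, ← hA', Category.assoc]
  rw [← cancel_epi (G.map (E ≫ P.hom)), ← Category.assoc, e, Category.assoc, ← H.map_comp,
    ← G.map_comp_assoc]
  simp only [Category.assoc, Iso.hom_inv_id_assoc]
  exact e'.symm

/-- Natural transformations defined on a costack can be glued from the members of a base. -/
theorem IsCostack.exists_hom (hQ : IsCostack Q) (hB : IsBase B) {G H : Q.val U ⥤ D}
    (α : ∀ S : Members B U, Q.push S.2.2 ⋙ G ⟶ Q.push S.2.2 ⋙ H)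
    (comm : ∀ (T S : Members B U) (h : T.1 ≤ S.1) (y : Q.val T.1),
      (α T).app y ≫ H.map ((Q.pushComp h S.2.2).hom.app y) =
        G.map ((Q.pushComp h S.2.2).hom.app y) ≫ (α S).app ((Q.push h).obj y)) :
    ∃ γ : G ⟶ H, ∀ (S : Members B U) (x : Q.val S.1),
      γ.app ((Q.push S.2.2).obj x) = (α S).app x := by
  refine hQ.exists_hom_of_iSup_eq (hB U) (fun S => S.2.2) α fun S S' x => ?_
  let r : Q.push (inf_le_left : S.1 ⊓ S'.1 ≤ S.1) ⋙ Q.push S.2.2 ⟶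
      Q.push (inf_le_right : S.1 ⊓ S'.1 ≤ S'.1) ⋙ Q.push S'.2.2 :=
    (Q.pushComp (inf_le_left : S.1 ⊓ S'.1 ≤ S.1) S.2.2).inv ≫
      (Q.pushComp (inf_le_right : S.1 ⊓ S'.1 ≤ S'.1) S'.2.2).hom
  let L : Q.push (inf_le_left : S.1 ⊓ S'.1 ≤ S.1) ⋙ Q.push S.2.2 ⋙ G ⟶
      Q.push (inf_le_right : S.1 ⊓ S'.1 ≤ S'.1) ⋙ Q.push S'.2.2 ⋙ H :=
    Functor.whiskerLeft (Q.push inf_le_left) (α S) ≫ Functor.whiskerRight r H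
  let R : Q.push (inf_le_left : S.1 ⊓ S'.1 ≤ S.1) ⋙ Q.push S.2.2 ⋙ G ⟶
      Q.push (inf_le_right : S.1 ⊓ S'.1 ≤ S'.1) ⋙ Q.push S'.2.2 ⋙ H :=
    Functor.whiskerRight r G ≫ Functor.whiskerLeft (Q.push inf_le_right) (α S')
  suffices hLR : L = R from NatTrans.congr_app hLR x
  -- `S ∩ S'` need not belong to `B`, so the equality over it is tested on the members `T` inside
  -- it.
  refine hQ.hom_ext hB fun T y => ?_
  have h₁ := Q.pushComp_assoc T.2.2 (inf_le_left : S.1 ⊓ S'.1 ≤ S.1) S.2.2 y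
  have h₂ := Q.pushComp_assoc T.2.2 (inf_le_right : S.1 ⊓ S'.1 ≤ S'.1) S'.2.2 y
  exact comp_map_eq_of_conj (E := (Q.pushComp T.2.2 (inf_le_left.trans S.2.2)).hom.app y)
    (P := (Q.pushComp (inf_le_left : S.1 ⊓ S'.1 ≤ S.1) S.2.2).app ((Q.push T.2.2).obj y)) h₁ h₂
    (comm (T.ofLE (inf_le_left.trans S.2.2)) S (T.2.2.trans inf_le_left) y)
    (comm (T.ofLE (inf_le_left.trans S.2.2)) S' (T.2.2.trans inf_le_right) y)
    ((α S).naturality ((Q.pushComp T.2.2 (inf_le_left : S.1 ⊓ S'.1 ≤ S.1)).hom.app y))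
    ((α S').naturality ((Q.pushComp T.2.2 (inf_le_right : S.1 ⊓ S'.1 ≤ S'.1)).hom.app y))

/-- A natural transformation between constant functors, given by a morphism on every object which
is invariant under isomorphisms. -/
def constHom {C D : Type*} [Category C] [Category D] {a b : D} (g : C → (a ⟶ b))
    (hg : ∀ {x y : C}, (x ⟶ y) → g x = g y) :
    (Functor.const C).obj a ⟶ (Functor.const C).obj b where
  app := g
  naturality _ _ f := (Category.id_comp _).trans ((hg f).symm.trans (Category.comp_id _).symm)

theorem comp_eq_of_assoc {C D : Type*} [Category C] [Category D] {G : C ⥤ D} {a w b c c' : C}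
    {d d' : D} {m : a ⟶ c} {E : a ⟶ w} {P : w ≅ c} {A' : a ⟶ b} {m' : b ⟶ c'} {P' : w ⟶ c'}
    {αa : G.obj a ⟶ d} {αc : G.obj c ⟶ d} {αb : G.obj b ⟶ d'} {αc' : G.obj c' ⟶ d'} {s : d ⟶ d'}
    (h : m = E ≫ P.hom) (h' : A' ≫ m' = E ≫ P') (hm : G.map m ≫ αc = αa)
    (hm' : G.map m' ≫ αc' = αb) (hs : αc ≫ s = G.map (P.inv ≫ P') ≫ αc') :
    αa ≫ s = G.map A' ≫ αb := by
  rw [← hm, ← hm', Category.assoc, hs, ← G.map_comp_assoc, ← G.map_comp_assoc, h', h]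
  simp

/-- A functor on a costack can be glued from constant functors on the members of a base. -/
theorem IsCostack.exists_functor (hQ : IsCostack Q) (hB : IsBase B) (b : Members B U → D)
    (t : ∀ T S : Members B U, T.1 ≤ S.1 → (b T ⟶ b S))
    (t_comp : ∀ (R S T : Members B U) (h : R.1 ≤ S.1) (h' : S.1 ≤ T.1),
      t R S h ≫ t S T h' = t R T (h.trans h')) :
    ∃ (G : Q.val U ⥤ D) (φ : ∀ S : Members B U, Q.push S.2.2 ⋙ G ⟶ (Functor.const _).obj (b S)),
      ∀ (T S : Members B U) (h : T.1 ≤ S.1) (y : Q.val T.1),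
        (φ T).app y ≫ t T S h =
          G.map ((Q.pushComp h S.2.2).hom.app y) ≫ (φ S).app ((Q.push h).obj y) := by
  -- The transition from `b S` to `b S'` passes through `b T` for each member `T` inside `S ∩ S'`.
  -- These morphisms are compatible by `t_comp`, hence glue over the intersection.
  have key (S S' : Members B U) : ∃ γ : (Functor.const (Q.val (S.1 ⊓ S'.1))).obj (b S) ⟶
      (Functor.const _).obj (b S'), ∀ (T : Members B (S.1 ⊓ S'.1)) (y : Q.val T.1),
        γ.app ((Q.push T.2.2).obj y) =
          inv (t (T.ofLE (inf_le_left.trans S.2.2)) S (T.2.2.trans inf_le_left)) ≫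
            t (T.ofLE (inf_le_left.trans S.2.2)) S' (T.2.2.trans inf_le_right) := by
    refine hQ.exists_hom hB (G := (Functor.const _).obj (b S)) (H := (Functor.const _).obj (b S'))
      (fun T => constHom (fun _ =>
        inv (t (T.ofLE (inf_le_left.trans S.2.2)) S (T.2.2.trans inf_le_left)) ≫
          t (T.ofLE (inf_le_left.trans S.2.2)) S' (T.2.2.trans inf_le_right)) fun _ => rfl)
      fun R T h y => ?_
    refine (Category.comp_id _).trans (Eq.trans ?_ (Category.id_comp _).symm)
    change inv _ ≫ _ = inv _ ≫ _
    rw [IsIso.inv_comp_eq, ← t_comp (R.ofLE (inf_le_left.trans S.2.2))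
      (T.ofLE (inf_le_left.trans S.2.2)) S h (T.2.2.trans inf_le_left),
      ← t_comp (R.ofLE (inf_le_left.trans S.2.2))
      (T.ofLE (inf_le_left.trans S.2.2)) S' h (T.2.2.trans inf_le_right), Category.assoc,
      IsIso.hom_inv_id_assoc]
  choose γ hγ using key
  have hγ' (S S' : Members B U) {x y : Q.val (S.1 ⊓ S'.1)} (f : x ⟶ y) :
      (γ S S').app x = (γ S S').app y :=
    (Category.comp_id _).symm.trans (((γ S S').naturality f).symm.trans (Category.id_comp _))
  have hγ'' (S S' : Members B U) {W : Opens X} (h : W ≤ S.1 ⊓ S'.1) (T : Members B W)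
      (y : Q.val T.1) : (γ S S').app ((Q.push h).obj ((Q.push T.2.2).obj y)) =
        inv (t (T.ofLE (h.trans (inf_le_left.trans S.2.2))) S
          (T.2.2.trans (h.trans inf_le_left))) ≫
        t (T.ofLE (h.trans (inf_le_left.trans S.2.2))) S' (T.2.2.trans (h.trans inf_le_right)) :=
    (hγ' S S' ((Q.pushComp T.2.2 h).hom.app y)).symm.trans (hγ S S' (T.ofLE h) y)
  have cocycle (S S' S'' : Members B U) (x : Q.val (S.1 ⊓ S'.1 ⊓ S''.1)) :
      (γ S S').app ((Q.push (le_inf (inf_le_left.trans inf_le_left)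
          (inf_le_left.trans inf_le_right))).obj x) ≫
        (γ S' S'').app ((Q.push (le_inf (inf_le_left.trans inf_le_right) inf_le_right)).obj x) =
      (γ S S'').app ((Q.push (le_inf (inf_le_left.trans inf_le_left) inf_le_right)).obj x) := by
    let ψ (R R' : Members B U) (h : S.1 ⊓ S'.1 ⊓ S''.1 ≤ R.1 ⊓ R'.1) :
        (Functor.const (Q.val (S.1 ⊓ S'.1 ⊓ S''.1))).obj (b R) ⟶ (Functor.const _).obj (b R') :=
      constHom (fun x => (γ R R').app ((Q.push h).obj x)) fun f => hγ' R R' ((Q.push h).map f)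
    have h : ψ S S' (le_inf (inf_le_left.trans inf_le_left) (inf_le_left.trans inf_le_right)) ≫
        ψ S' S'' (le_inf (inf_le_left.trans inf_le_right) inf_le_right) =
        ψ S S'' (le_inf (inf_le_left.trans inf_le_left) inf_le_right) := by
      refine hQ.hom_ext hB fun T y => ?_
      refine (congrArg₂ (· ≫ ·) (hγ'' S S' _ T y) (hγ'' S' S'' _ T y)).trans
        (Eq.trans ?_ (hγ'' S S'' _ T y).symm)
      simp only [Category.assoc, IsIso.hom_inv_id_assoc]
    exact NatTrans.congr_app h x
  let A : Cocone Q (fun S : Members B U => S.1) D :=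
    { obj S := (Functor.const _).obj (b S)
      iso S S' := NatIso.ofComponents (fun x => asIso ((γ S S').app x)) fun f =>
        (γ S S').naturality f
      cocycle S S' S'' x := by
        have e (R R' : Members B U) (h : S.1 ⊓ S'.1 ⊓ S''.1 ≤ R.1 ⊓ R'.1) :
            𝟙 (b R) ≫ (γ R R').app ((Q.push h).obj x) ≫ 𝟙 (b R') =
              (γ R R').app ((Q.push h).obj x) :=
          (Category.id_comp _).trans (Category.comp_id _)
        exact (congrArg₂ (· ≫ ·) (e S S' _) (e S' S'' _)).trans
          ((cocycle S S' S'' x).trans (e S S'' _).symm) }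
  obtain ⟨G, φ, hφ⟩ := hQ.exists_functor_of_iSup_eq (hB U) (fun S => S.2.2) A
  refine ⟨G, φ, fun T S h y => ?_⟩
  have ht : t T T le_rfl = 𝟙 _ := by
    rw [← cancel_epi (t T T le_rfl), t_comp, Category.comp_id]
  -- The cocone gives compatibility over `T ∩ S`. This is `T` again, but only propositionally, so
  -- the result is carried along `T ≤ T ∩ S ≤ T` by associativity and unit coherence.
  have hTS : T.1 ≤ T.1 ⊓ S.1 := le_inf le_rfl h
  have h₁ := Q.pushComp_assoc hTS (inf_le_left : T.1 ⊓ S.1 ≤ T.1) T.2.2 y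
  have h₂ := Q.pushComp_assoc hTS (inf_le_right : T.1 ⊓ S.1 ≤ S.1) S.2.2 y
  rw [Q.pushComp_refl_left, ← Functor.map_comp] at h₁
  have n₁ := ((φ T).naturality ((Q.pushId T.1).inv.app y ≫
    (Q.pushComp hTS (inf_le_left : T.1 ⊓ S.1 ≤ T.1)).hom.app y)).trans (Category.comp_id _)
  have n₂ := ((φ S).naturality ((Q.pushComp hTS (inf_le_right : T.1 ⊓ S.1 ≤ S.1)).hom.app y)).trans
    (Category.comp_id _)
  have e := hφ T S ((Q.push hTS).obj y)
  have g : (A.iso T S).hom.app ((Q.push hTS).obj y) = t T S h := by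
    refine (hγ T S ⟨T.1, T.2.1, hTS⟩ y).trans ?_
    change inv (t T T le_rfl) ≫ t T S h = t T S h
    rw [IsIso.inv_comp_eq, ht, Category.id_comp]
  exact comp_eq_of_assoc (P := (Q.pushComp (inf_le_left : T.1 ⊓ S.1 ≤ T.1) T.2.2).app
    ((Q.push hTS).obj y)) h₁ h₂ n₁ n₂ ((congrArg (_ ≫ ·) g).symm.trans e)

end Gluing

/-! ### Morphisms of 2-functors and modifications in components. -/

section Transformations

variable {X : Type u} [TopologicalSpace X] {Q P : OpenFunctor X}

/-- The component `Q(U) ⥤ P(U)` of a morphism of 2-functors. -/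
def component (f : Q ⟶ P) (U : Opens X) : Q.val U ⥤ P.val U := f.app ⟨U⟩

/-- The naturality isomorphism of a morphism of 2-functors for `W ⊆ U`. -/
def naturalityIso (f : Q ⟶ P) {W U : Opens X} (h : W ≤ U) :
    Q.push h ⋙ component f U ≅ component f W ⋙ P.push h :=
  f.naturality (homOfLE h).toLoc

theorem naturalityIso_comp (f : Q ⟶ P) {W V U : Opens X} (h₁ : W ≤ V) (h₂ : V ≤ U)
    (x : Q.val W) :
    (naturalityIso f (h₁.trans h₂)).hom.app x ≫
        (P.pushComp h₁ h₂).hom.app ((component f W).obj x) =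
      (component f U).map ((Q.pushComp h₁ h₂).hom.app x) ≫
        (naturalityIso f h₂).hom.app ((Q.push h₁).obj x) ≫
        (P.push h₂).map ((naturalityIso f h₁).hom.app x) := by
  refine (congrArg (fun t => NatTrans.app t x)
    (f.naturality_comp (homOfLE h₁).toLoc (homOfLE h₂).toLoc)).trans ?_
  refine congrArg (_ ≫ ·) ((Category.id_comp _).trans (congrArg (_ ≫ ·) ?_))
  exact (Category.id_comp _).trans (Category.comp_id _)

/-- A morphism of 2-functors on the opens of `X` from its components. -/
def mkTrans (app : ∀ U, Q.val U ⥤ P.val U)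
    (nat : ∀ {W U : Opens X} (h : W ≤ U), Q.push h ⋙ app U ≅ app W ⋙ P.push h)
    (nat_id : ∀ (U : Opens X) (x : Q.val U),
      (nat (le_refl U)).hom.app x ≫ (P.pushId U).hom.app ((app U).obj x) =
        (app U).map ((Q.pushId U).hom.app x))
    (nat_comp : ∀ {W V U : Opens X} (h₁ : W ≤ V) (h₂ : V ≤ U) (x : Q.val W),
      (nat (h₁.trans h₂)).hom.app x ≫ (P.pushComp h₁ h₂).hom.app ((app W).obj x) =
        (app U).map ((Q.pushComp h₁ h₂).hom.app x) ≫ (nat h₂).hom.app ((Q.push h₁).obj x) ≫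
          (P.push h₂).map ((nat h₁).hom.app x)) : Q ⟶ P :=
  Pseudofunctor.StrongTrans.mk (F := Q) (G := P)
    (fun U => app U.as)
    (fun f => nat (leOfHom f.as))
    (fun {_ V f g} η => by
      obtain rfl : f = g := LocallyDiscrete.eq_of_hom η
      obtain rfl : η = 𝟙 f := Subsingleton.elim _ _
      rw [Q.map₂_id, P.map₂_id]
      apply NatTrans.ext
      funext x
      refine (congrArg (· ≫ _) ((app V.as).map_id _)).trans ((Category.id_comp _).trans ?_)
      exact (Category.comp_id _).symm)
    (fun U => by
      apply NatTrans.ext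
      funext x
      exact (nat_id U.as x).trans ((congrArg (_ ≫ ·) (Category.id_comp _)).trans
        (Category.comp_id _)).symm)
    (fun {U V W} f g => by
      apply NatTrans.ext
      funext x
      refine (nat_comp (leOfHom f.as) (leOfHom g.as) x).trans (Eq.symm ?_)
      refine congrArg (_ ≫ ·) ((Category.id_comp _).trans (congrArg (_ ≫ ·) ?_))
      exact (Category.id_comp _).trans (Category.comp_id _))

/-- A modification from its components. -/
def mkModification {f g : Q ⟶ P} (m : ∀ U, component f U ⟶ component g U)
    (hm : ∀ {W U : Opens X} (h : W ≤ U) (x : Q.val W),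
      (m U).app ((Q.push h).obj x) ≫ (naturalityIso g h).hom.app x =
        (naturalityIso f h).hom.app x ≫ (P.push h).map ((m W).app x)) : f ⟶ g :=
  ⟨{ app U := m U.as
     naturality h := NatTrans.ext (funext fun x => hm (leOfHom h.as) x) }⟩

/-- The component of a modification. -/
def modComponent {f g : Q ⟶ P} (m : f ⟶ g) (U : Opens X) : component f U ⟶ component g U :=
  m.as.app ⟨U⟩

theorem modComponent_naturality {f g : Q ⟶ P} (m : f ⟶ g) {W U : Opens X} (h : W ≤ U)
    (x : Q.val W) :
    (modComponent m U).app ((Q.push h).obj x) ≫ (naturalityIso g h).hom.app x =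
      (naturalityIso f h).hom.app x ≫ (P.push h).map ((modComponent m W).app x) :=
  congrArg (fun t => NatTrans.app t x) (m.as.naturality (homOfLE h).toLoc)

theorem modification_ext {f g : Q ⟶ P} {m m' : f ⟶ g}
    (h : ∀ U, modComponent m U = modComponent m' U) : m = m' :=
  Pseudofunctor.StrongTrans.homCategory.ext fun U => h U.as

end Transformations

/-- A category is contractible if it is equivalent to the category with one object and one
morphism. -/
def IsContractible (C : Type*) [Category C] : Prop :=
  Nonempty C ∧ ∀ x y : C, Nonempty (Unique (x ⟶ y))

theorem IsContractible.hom_eq {C : Type*} [Category C] (h : IsContractible C) {x y : C}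
    (f g : x ⟶ y) : f = g :=
  have := (h.2 x y).some
  Subsingleton.elim f g

theorem IsContractible.isEquivalence {C D : Type*} [Category C] [Category D]
    (hC : IsContractible C) (hD : IsContractible D) (F : C ⥤ D) : F.IsEquivalence where
  faithful := ⟨fun _ => hC.hom_eq _ _⟩
  full := ⟨fun _ => ⟨(hC.2 _ _).some.default, hD.hom_eq _ _⟩⟩
  essSurj := ⟨fun _ => ⟨hC.1.some,
    ⟨⟨(hD.2 _ _).some.default, (hD.2 _ _).some.default, hD.hom_eq _ _, hD.hom_eq _ _⟩⟩⟩⟩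

/-! ### Existence and uniqueness of modifications. -/

section Modifications

theorem eq_of_conj {C : Type*} [Groupoid C] {a b c d e : C} {q : a ⟶ b} {l : b ⟶ c} {s : c ⟶ d}
    {t : b ⟶ e} {r : e ⟶ d} (h : q ≫ l = q ≫ t ≫ r ≫ inv s) : l ≫ s = t ≫ r := by
  rw [cancel_epi, ← Category.assoc, IsIso.eq_comp_inv] at h
  exact h

/-- One chase serves `exists_modification` twice: for `T ⊆ S ⊆ U`, to glue over `U`, and for `S ⊆ W
⊆ U`, to check naturality. In both cases `hf` and `hg` are the composition axioms of the two
morphisms, and `hm` is naturality of `pushComp`. -/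
theorem conj_comp_eq {C E : Type*} [Groupoid C] [Groupoid E] (F : E ⥤ C) {a a' b b' p r : C}
    {e e' p' r' : E} {fT : a ⟶ p} {κf : p ⟶ F.obj p'} {qf : a ⟶ a'} {fS : a' ⟶ F.obj e}
    {fTS : e ⟶ p'} {gT : b ⟶ r} {κg : r ⟶ F.obj r'} {qg : b ⟶ b'} {gS : b' ⟶ F.obj e'}
    {gTS : e' ⟶ r'} {mT : p ⟶ r} {mT' : p' ⟶ r'} {mS : e ⟶ e'}
    (hf : fT ≫ κf = qf ≫ fS ≫ F.map fTS) (hg : gT ≫ κg = qg ≫ gS ≫ F.map gTS)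
    (hm : mT ≫ κg = κf ≫ F.map mT') (hS : mS ≫ gTS = fTS ≫ mT') :
    (fT ≫ mT ≫ inv gT) ≫ qg = qf ≫ fS ≫ F.map mS ≫ inv gS := by
  rw [← cancel_mono (gS ≫ F.map gTS)]
  simp only [Category.assoc, IsIso.inv_hom_id_assoc]
  rw [← hg, IsIso.inv_hom_id_assoc, hm, reassoc_of% hf, ← F.map_comp, ← F.map_comp, hS]

variable {X : Type u} [TopologicalSpace X] {Q P : OpenFunctor X} {B : Set (Opens X)}

/-- On a member `S` of the base the components agree because `P(S)` is contractible. Naturality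
determines the component over `U` on everything coming from `Q(S)`, and such objects suffice by
`IsCostack.hom_ext`. -/
theorem modification_unique (hQ : IsCostack Q) (hB : IsBase B)
    (hP : ∀ S ∈ B, IsContractible (P.val S)) {f g : Q ⟶ P} (m m' : f ⟶ g) : m = m' := by
  refine modification_ext fun U => hQ.hom_ext hB fun S x => ?_
  rw [← cancel_mono ((naturalityIso g S.2.2).hom.app x), modComponent_naturality,
    modComponent_naturality, (hP S.1 S.2.1).hom_eq ((modComponent m S.1).app x)]

theorem exists_modification (hQ : IsCostack Q) (hB : IsBase B)
    (hP : ∀ S ∈ B, IsContractible (P.val S)) (f g : Q ⟶ P) : Nonempty (f ⟶ g) := by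
  let u (S : Opens X) (hS : S ∈ B) : component f S ⟶ component g S :=
    { app x := ((hP S hS).2 _ _).some.default
      naturality _ _ _ := (hP S hS).hom_eq _ _ }
  -- The unique transformation over `S`, conjugated by the naturality isomorphisms of `f` and `g`:
  -- naturality forces this value over `U`.
  let α (U : Opens X) (S : Members B U) :
      Q.push S.2.2 ⋙ component f U ⟶ Q.push S.2.2 ⋙ component g U :=
    (naturalityIso f S.2.2).hom ≫ Functor.whiskerRight (u S.1 S.2.1) (P.push S.2.2) ≫
      (naturalityIso g S.2.2).inv
  have hα (U : Opens X) (S : Members B U) (x : Q.val S.1) :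
      (α U S).app x = (naturalityIso f S.2.2).hom.app x ≫
        (P.push S.2.2).map ((u S.1 S.2.1).app x) ≫ inv ((naturalityIso g S.2.2).hom.app x) := by
    refine congrArg (_ ≫ ·) (congrArg (_ ≫ ·) ?_)
    exact IsIso.eq_inv_of_hom_inv_id (Iso.hom_inv_id_app _ _)
  have key (U : Opens X) : ∃ γ : component f U ⟶ component g U, ∀ (S : Members B U)
      (x : Q.val S.1), γ.app ((Q.push S.2.2).obj x) = (α U S).app x := by
    refine hQ.exists_hom hB (α U) fun T S h y => ?_
    rw [hα, hα]
    exact conj_comp_eq (P.push S.2.2) (naturalityIso_comp f h S.2.2 y)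
      (naturalityIso_comp g h S.2.2 y)
      ((P.pushComp h S.2.2).hom.naturality ((u T.1 T.2.1).app y)) ((hP S.1 S.2.1).hom_eq _ _)
  choose m hm using key
  refine ⟨mkModification m fun {W U} h x => ?_⟩
  let L : Q.push h ⋙ component f U ⟶ component g W ⋙ P.push h :=
    Functor.whiskerLeft (Q.push h) (m U) ≫ (naturalityIso g h).hom
  let R : Q.push h ⋙ component f U ⟶ component g W ⋙ P.push h :=
    (naturalityIso f h).hom ≫ Functor.whiskerRight (m W) (P.push h)
  suffices hLR : L = R from NatTrans.congr_app hLR x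
  refine hQ.hom_ext hB fun S y => ?_
  have h₁ := hm U (S.ofLE h) y
  have h₂ := hm W S y
  rw [hα] at h₁ h₂
  have h₃ := (m U).naturality ((Q.pushComp S.2.2 h).hom.app y)
  have h₄ := conj_comp_eq (P.push h) (naturalityIso_comp f S.2.2 h y)
    (naturalityIso_comp g S.2.2 h y)
    ((P.pushComp S.2.2 h).hom.naturality ((u S.1 S.2.1).app y))
    (mS := (m W).app ((Q.push S.2.2).obj y)) (by rw [h₂]; simp)
  exact eq_of_conj (h₃.trans ((congrArg (· ≫ _) h₁).trans h₄))

end Modifications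

/-! ### Existence of a morphism from a costack. -/

section Framing

variable {X : Type u} [TopologicalSpace X]

/-- A 2-functor `P` with compatible objects on the members of a family of open subsets. -/
structure BasedFunctor (P : OpenFunctor X) (B : Set (Opens X)) where
  pt (S : Opens X) (hS : S ∈ B) : P.val S
  hom {T S : Opens X} (hT : T ∈ B) (hS : S ∈ B) (h : T ≤ S) : (P.push h).obj (pt T hT) ⟶ pt S hS
  hom_comp {R S T : Opens X} (hR : R ∈ B) (hS : S ∈ B) (hT : T ∈ B) (h : R ≤ S) (h' : S ≤ T) :
    (P.pushComp h h').hom.app (pt R hR) ≫ (P.push h').map (hom hR hS h) ≫ hom hS hT h' =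
      hom hR hT (h.trans h')

variable {P Q : OpenFunctor X} {B : Set (Opens X)}

/-- The points are arbitrary; the morphisms between them exist and are coherent because each hom set
in `P(S)` is a singleton. -/
theorem exists_basedFunctor (hP : ∀ S ∈ B, IsContractible (P.val S)) :
    Nonempty (BasedFunctor P B) :=
  ⟨{ pt S hS := (hP S hS).1.some
     hom _ hS _ := ((hP _ hS).2 _ _).some.default
     hom_comp _ _ hT _ _ := (hP _ hT).hom_eq _ _ }⟩

namespace BasedFunctor

variable (b : BasedFunctor P B)

theorem comp_comp_eq_of_squares {C : Type*} [Category C] {a b c d e f : C} {A : a ⟶ b}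
    {A' : b ⟶ c} {E : a ⟶ d} {E' : d ⟶ c} {G : d ⟶ e} {G' : e ⟶ f} {H : c ⟶ f}
    (h : A ≫ A' = E ≫ E') (h' : G ≫ G' = E' ≫ H) : A ≫ A' ≫ H = (E ≫ G) ≫ G' := by
  rw [reassoc_of% h, Category.assoc, h']

/-- The image of a base object in a larger open subset. -/
def image {U : Opens X} (S : Members B U) : P.val U := (P.push S.2.2).obj (b.pt S.1 S.2.1)

/-- The morphism between the images of two base objects. -/
def imageHom {U : Opens X} (T S : Members B U) (h : T.1 ≤ S.1) : b.image T ⟶ b.image S :=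
  (P.pushComp h S.2.2).hom.app (b.pt T.1 T.2.1) ≫ (P.push S.2.2).map (b.hom T.2.1 S.2.1 h)

theorem pushComp_imageHom {W U : Opens X} (hWU : W ≤ U) (T S : Members B W) (h : T.1 ≤ S.1) :
    (P.pushComp T.2.2 hWU).hom.app (b.pt T.1 T.2.1) ≫ (P.push hWU).map (b.imageHom T S h) =
      b.imageHom (T.ofLE hWU) (S.ofLE hWU) h ≫
        (P.pushComp S.2.2 hWU).hom.app (b.pt S.1 S.2.1) := by
  have e := P.pushComp_assoc h S.2.2 hWU (b.pt T.1 T.2.1)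
  have n := (P.pushComp S.2.2 hWU).hom.naturality (b.hom T.2.1 S.2.1 h)
  refine Eq.trans (congrArg ((P.pushComp T.2.2 hWU).hom.app (b.pt T.1 T.2.1) ≫ ·)
    ((P.push hWU).map_comp _ _)) ?_
  exact comp_comp_eq_of_squares e n

theorem imageHom_comp {U : Opens X} (R S T : Members B U) (h : R.1 ≤ S.1) (h' : S.1 ≤ T.1) :
    b.imageHom R S h ≫ b.imageHom S T h' = b.imageHom R T (h.trans h') := by
  have e := b.pushComp_imageHom T.2.2 ⟨R.1, R.2.1, h.trans h'⟩ ⟨S.1, S.2.1, h'⟩ h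
  have c := b.hom_comp R.2.1 S.2.1 T.2.1 h h'
  refine (Category.assoc _ _ _).symm.trans ((congrArg (· ≫ _) e.symm).trans ?_)
  refine (Category.assoc _ _ _).trans (congrArg (_ ≫ ·) ?_)
  exact ((P.push T.2.2).map_comp _ _).symm.trans (congrArg _ ((Category.assoc _ _ _).trans c))

/-- A functor `Q(U) ⥤ P(U)` whose restriction to `Q(S)` is identified with the constant functor at
the base object, for all members `S` of the family contained in `U`. -/
structure Framing (Q : OpenFunctor X) (U : Opens X) where
  functor : Q.val U ⥤ P.val U
  frame (S : Members B U) : Q.push S.2.2 ⋙ functor ⟶ (Functor.const _).obj (b.image S)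
  comm (T S : Members B U) (h : T.1 ≤ S.1) (y : Q.val T.1) :
    (frame T).app y ≫ b.imageHom T S h =
      functor.map ((Q.pushComp h S.2.2).hom.app y) ≫ (frame S).app ((Q.push h).obj y)

theorem exists_framing (hQ : IsCostack Q) (hB : IsBase B) (U : Opens X) :
    Nonempty (b.Framing Q U) := by
  obtain ⟨G, φ, h⟩ := hQ.exists_functor hB b.image b.imageHom b.imageHom_comp
  exact ⟨⟨G, φ, h⟩⟩

variable {b}

theorem Framing.frame_naturality {U : Opens X} (F : b.Framing Q U) (S : Members B U)
    {x y : Q.val S.1} (f : x ⟶ y) :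
    F.functor.map ((Q.push S.2.2).map f) ≫ (F.frame S).app y = (F.frame S).app x :=
  ((F.frame S).naturality f).trans (Category.comp_id _)

/-- This and `conj_comm` give naturality over each member, and compatibility between members, of the
comparison in `Framing.exists_hom`, which follows the frame of `F'`, the coherence of `P` and the
inverse frame of `F`. -/
theorem conj_naturality {C : Type*} [Groupoid C] {a₁ a₂ b₁ b₂ c d e₁ e₂ : C} {g₁ : a₁ ⟶ a₂}
    {g₂ : b₁ ⟶ b₂} {g₃ : e₁ ⟶ e₂} {i₁ : a₁ ⟶ b₁} {i₂ : a₂ ⟶ b₂} {φ₁ : b₁ ⟶ c} {φ₂ : b₂ ⟶ c}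
    {k : c ⟶ d} {ψ₁ : e₁ ⟶ d} {ψ₂ : e₂ ⟶ d} (hi : g₁ ≫ i₂ = i₁ ≫ g₂) (hφ : g₂ ≫ φ₂ = φ₁)
    (hψ : g₃ ≫ ψ₂ = ψ₁) : g₁ ≫ i₂ ≫ φ₂ ≫ k ≫ inv ψ₂ = (i₁ ≫ φ₁ ≫ k ≫ inv ψ₁) ≫ g₃ := by
  subst hφ hψ
  rw [reassoc_of% hi]
  simp

theorem conj_comm {C : Type*} [Groupoid C] {a₁ a₂ b₁ b₂ c₁ c₂ d₁ d₂ e₁ e₂ : C}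
    {q₁ : b₁ ⟶ a₁} {q₂ : b₂ ⟶ a₂} {q₃ : a₁ ⟶ a₂} {q₄ : b₁ ⟶ b₂} {φ₁ : b₁ ⟶ c₁} {φ₂ : b₂ ⟶ c₂}
    {κ₁ : c₁ ⟶ d₁} {κ₂ : c₂ ⟶ d₂} {ψ₁ : e₁ ⟶ d₁} {ψ₂ : e₂ ⟶ d₂} {t : c₁ ⟶ c₂} {s : d₁ ⟶ d₂}
    {g : e₁ ⟶ e₂} (hq : q₁ ≫ q₃ = q₄ ≫ q₂) (hφ : φ₁ ≫ t = q₄ ≫ φ₂) (hκ : κ₁ ≫ s = t ≫ κ₂)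
    (hψ : ψ₁ ≫ s = g ≫ ψ₂) :
    (inv q₁ ≫ φ₁ ≫ κ₁ ≫ inv ψ₁) ≫ g = q₃ ≫ inv q₂ ≫ φ₂ ≫ κ₂ ≫ inv ψ₂ := by
  have h₁ : g = ψ₁ ≫ s ≫ inv ψ₂ := by rw [reassoc_of% hψ]; simp
  have h₂ : q₃ = inv q₁ ≫ q₄ ≫ q₂ := by rw [← hq]; simp
  rw [h₁, h₂]
  simp only [Category.assoc, IsIso.inv_hom_id_assoc, IsIso.hom_inv_id_assoc]
  rw [reassoc_of% hκ, reassoc_of% hφ]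

theorem conj_comp {C : Type*} [Groupoid C] {a b c d e : C} (q : b ⟶ a) (φ : b ⟶ c) (κ : c ⟶ d)
    (ψ : e ⟶ d) : (inv q ≫ φ ≫ κ ≫ inv ψ) ≫ ψ = inv q ≫ φ ≫ κ := by
  simp

/-- Two framed functors are canonically isomorphic after a change of open subset. -/
theorem Framing.exists_hom (hQ : IsCostack Q) (hB : IsBase B) {W U : Opens X} (h : W ≤ U)
    (F : b.Framing Q W) (F' : b.Framing Q U) :
    ∃ γ : Q.push h ⋙ F'.functor ⟶ F.functor ⋙ P.push h, ∀ (S : Members B W) (y : Q.val S.1),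
      γ.app ((Q.push S.2.2).obj y) ≫ (P.push h).map ((F.frame S).app y) =
        inv (F'.functor.map ((Q.pushComp S.2.2 h).hom.app y)) ≫ (F'.frame (S.ofLE h)).app y ≫
          (P.pushComp S.2.2 h).hom.app (b.pt S.1 S.2.1) := by
  let α (S : Members B W) : Q.push S.2.2 ⋙ Q.push h ⋙ F'.functor ⟶
      Q.push S.2.2 ⋙ F.functor ⋙ P.push h :=
    { app y := inv (F'.functor.map ((Q.pushComp S.2.2 h).hom.app y)) ≫
        (F'.frame (S.ofLE h)).app y ≫ (P.pushComp S.2.2 h).hom.app (b.pt S.1 S.2.1) ≫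
        inv ((P.push h).map ((F.frame S).app y))
      naturality x y f := by
        refine conj_naturality (g₂ := F'.functor.map ((Q.push (S.2.2.trans h)).map f)) ?_
          (F'.frame_naturality (S.ofLE h) f) ?_
        · rw [IsIso.comp_inv_eq, Category.assoc, IsIso.eq_inv_comp, ← Functor.map_comp]
          refine (F'.functor.map_comp _ _).symm.trans (congrArg _ ?_)
          exact ((Q.pushComp S.2.2 h).hom.naturality f).symm
        · exact ((P.push h).map_comp _ _).symm.trans (congrArg _ (F.frame_naturality S f)) }
  obtain ⟨γ, hγ⟩ := hQ.exists_hom hB α fun T S hTS y => by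
    refine conj_comm (q₄ := F'.functor.map ((Q.pushComp hTS (S.2.2.trans h)).hom.app y)) ?_
      (F'.comm (T.ofLE h) (S.ofLE h) hTS y) (b.pushComp_imageHom h T S hTS) ?_
    · exact (F'.functor.map_comp _ _).symm.trans ((congrArg _
        (Q.pushComp_assoc hTS S.2.2 h y)).trans (F'.functor.map_comp _ _))
    · exact ((P.push h).map_comp _ _).symm.trans ((congrArg _ (F.comm T S hTS y)).trans
        ((P.push h).map_comp _ _))
  refine ⟨γ, fun S y => ?_⟩
  rw [hγ]
  exact conj_comp _ _ _ _

end BasedFunctor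

theorem unit_eq {C : Type*} [Groupoid C] {a s c d e : C} {ν : a ⟶ e} {ψ : e ⟶ d} {q : s ⟶ a}
    {φ : s ⟶ c} {κ : c ⟶ d} {ι : e ⟶ s} {ι' : d ⟶ c} {j : a ⟶ s}
    (hν : ν ≫ ψ = inv q ≫ φ ≫ κ) (hι : ψ ≫ ι' = ι ≫ φ) (hκ : κ ≫ ι' = 𝟙 c) (hj : q ≫ j = 𝟙 s) :
    ν ≫ ι = j := by
  rw [← cancel_mono φ, Category.assoc, ← hι, reassoc_of% hν, hκ, Category.comp_id,
    IsIso.inv_eq_of_hom_inv_id hj]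

/-- The composition axiom for `W ⊆ V ⊆ U`, tested on the base: `h₁`, `h₂`, `h₃` are the defining
equations of the three comparisons, `h₄` and `h₅` are naturality, `h₆` and `h₇` are the
associativity coherences of `P` and `Q`. The unit axiom is `unit_eq`. -/
theorem comp_eq {C E : Type*} [Groupoid C] [Groupoid E] (F : E ⥤ C) {a s c d₁ p a₃ a₄ : C}
    {p' d₂ a₂ s₂ c₂ : E} {ν₁ : a ⟶ p} {ψ₁ : p ⟶ d₁} {q₁ : s ⟶ a} {φ : s ⟶ c} {κ₁ : c ⟶ d₁}
    {ρ : p ⟶ F.obj p'} {ψ₂ : p' ⟶ d₂} {ρ' : d₁ ⟶ F.obj d₂} {ν₂ : a₂ ⟶ p'} {q₂ : s₂ ⟶ a₂}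
    {φ₂ : s₂ ⟶ c₂} {κ₂ : c₂ ⟶ d₂} {ν₃ : a₃ ⟶ F.obj s₂} {q₃ : s ⟶ a₃} {κ₃ : c ⟶ F.obj c₂}
    {t : a₃ ⟶ a₄} {ν₄ : a₄ ⟶ F.obj a₂} {r : a ⟶ a₄}
    (h₁ : ν₁ ≫ ψ₁ = inv q₁ ≫ φ ≫ κ₁) (h₂ : ν₂ ≫ ψ₂ = inv q₂ ≫ φ₂ ≫ κ₂)
    (h₃ : ν₃ ≫ F.map φ₂ = inv q₃ ≫ φ ≫ κ₃) (h₄ : t ≫ ν₄ = ν₃ ≫ F.map q₂)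
    (h₅ : ψ₁ ≫ ρ' = ρ ≫ F.map ψ₂) (h₆ : κ₃ ≫ F.map κ₂ = κ₁ ≫ ρ') (h₇ : q₃ ≫ t = q₁ ≫ r) :
    ν₁ ≫ ρ = r ≫ ν₄ ≫ F.map ν₂ := by
  rw [← cancel_mono (F.map ψ₂), ← cancel_epi q₁]
  simp only [Category.assoc]
  rw [← h₅, reassoc_of% h₁, IsIso.hom_inv_id_assoc, ← h₆, ← F.map_comp, h₂, ← reassoc_of% h₇,
    reassoc_of% h₄, F.map_comp, F.map_comp, Functor.map_inv, IsIso.hom_inv_id_assoc,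
    reassoc_of% h₃, IsIso.hom_inv_id_assoc]

/-- There is a morphism from any costack to a 2-functor which is contractible on a base. -/
theorem exists_trans (hQ : IsCostack Q) (hB : IsBase B)
    (hP : ∀ S ∈ B, IsContractible (P.val S)) : Nonempty (Q ⟶ P) := by
  obtain ⟨b⟩ := exists_basedFunctor hP
  let F (U : Opens X) : b.Framing Q U := (b.exists_framing hQ hB U).some
  -- The framed functors are chosen independently for each `U`. The equations `hN` fix the
  -- comparisons on the base, which is why these satisfy the coherence axioms whatever choices were
  -- made.
  choose N hN using fun (W U : Opens X) (h : W ≤ U) =>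
    BasedFunctor.Framing.exists_hom hQ hB h (F W) (F U)
  refine ⟨mkTrans (fun U => (F U).functor)
    (fun {W U} h => NatIso.ofComponents (fun x => asIso ((N W U h).app x))
      fun f => (N W U h).naturality f) (fun U x => ?_) fun {W V U} h₁ h₂ x => ?_⟩
  · let L : Q.push le_rfl ⋙ (F U).functor ⟶ (F U).functor :=
      N U U le_rfl ≫ Functor.whiskerLeft (F U).functor (P.pushId U).hom
    let R : Q.push le_rfl ⋙ (F U).functor ⟶ (F U).functor :=
      Functor.whiskerRight (Q.pushId U).hom (F U).functor
    suffices hLR : L = R from NatTrans.congr_app hLR x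
    refine hQ.hom_ext hB fun S y => ?_
    refine unit_eq (hN U U le_rfl S y) ((P.pushId U).hom.naturality (((F U).frame S).app y)) ?_ ?_
    · rw [P.pushComp_refl_right]
      exact Iso.inv_hom_id_app _ _
    · rw [Q.pushComp_refl_right]
      exact ((F U).functor.map_comp _ _).symm.trans ((congrArg _ (Iso.inv_hom_id_app _ _)).trans
        ((F U).functor.map_id _))
  · let L : Q.push (h₁.trans h₂) ⋙ (F U).functor ⟶ (F W).functor ⋙ P.push h₁ ⋙ P.push h₂ :=
      N W U (h₁.trans h₂) ≫ Functor.whiskerLeft (F W).functor (P.pushComp h₁ h₂).hom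
    let R : Q.push (h₁.trans h₂) ⋙ (F U).functor ⟶ (F W).functor ⋙ P.push h₁ ⋙ P.push h₂ :=
      Functor.whiskerRight (Q.pushComp h₁ h₂).hom (F U).functor ≫
        Functor.whiskerLeft (Q.push h₁) (N V U h₂) ≫ Functor.whiskerRight (N W V h₁) (P.push h₂)
    suffices hLR : L = R from NatTrans.congr_app hLR x
    refine hQ.hom_ext hB fun S y => ?_
    refine comp_eq (P.push h₂) (hN W U (h₁.trans h₂) S y) (hN W V h₁ S y)
      (hN V U h₂ (S.ofLE h₁) y) ((N V U h₂).naturality ((Q.pushComp S.2.2 h₁).hom.app y))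
      ((P.pushComp h₁ h₂).hom.naturality (((F W).frame S).app y))
      (P.pushComp_assoc S.2.2 h₁ h₂ (b.pt S.1 S.2.1)) ?_
    exact ((F U).functor.map_comp _ _).symm.trans ((congrArg _
      (Q.pushComp_assoc S.2.2 h₁ h₂ y)).trans ((F U).functor.map_comp _ _))

/-- The category of morphisms from a costack to a 2-functor which is contractible on a base is
contractible. -/
theorem isContractible_hom (hQ : IsCostack Q) (hB : IsBase B)
    (hP : ∀ S ∈ B, IsContractible (P.val S)) : IsContractible (Q ⟶ P) :=
  ⟨exists_trans hQ hB hP, fun f g =>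
    ⟨{ default := (exists_modification hQ hB hP f g).some
       uniq _ := modification_unique hQ hB hP _ _ }⟩⟩

end Framing

theorem isTwoTerminal_of_isContractible {C : Type*} [Bicategory C] {t : C}
    (h : ∀ x : C, IsContractible (x ⟶ t)) : IsTwoTerminal t := fun x =>
  (equiv_punit_iff_unique _).mpr (h x)

/-! ### Simply connected open subsets as a base with contractible values. -/

section Good

variable {X : Type u} [TopologicalSpace X]

theorem IsGood.isBase (hX : IsGood X) : IsBase {S : Opens X | IsSimplyConnected (S : Set X)} := by
  intro U
  refine le_antisymm (iSup_le fun S => S.2.2) ?_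
  obtain ⟨ι, V, rfl, hV, -, -⟩ := hX U
  exact iSup_le fun i => le_iSup (fun S : Members {S : Opens X | IsSimplyConnected (S : Set X)}
    (⨆ i, V i) => S.1) ⟨V i, hV i, le_iSup V i⟩

theorem isContractible_fundamentalGroupoid {S : Opens X} (hS : IsSimplyConnected (S : Set X)) :
    IsContractible ((fundamentalGroupoid X).val S) :=
  (equiv_punit_iff_unique _).mp hS.simplyConnectedSpace.equiv_unit

theorem isContractible_constOne (U : Opens X) : IsContractible ((constOne X).val U) :=
  (equiv_punit_iff_unique _).mp ⟨CategoryTheory.Equivalence.refl (C := Discrete PUnit.{u + 1})⟩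

end Good

end Costacks

theorem mainTheorem2 (X : Type u) [TopologicalSpace X] (hX : Costacks.IsGood X) :
    (∃ p : Costacks.fundamentalGroupoid X ⟶ Costacks.constOne X,
      Costacks.IsAssociatedCostack p) ∧
    ∃ h : Costacks.IsCostack (Costacks.fundamentalGroupoid X),
      Costacks.IsTwoTerminal (B := Costacks.CostackCat X)
        ⟨Costacks.fundamentalGroupoid X, h⟩ := by
  have hpi₁ := Costacks.isCostack_fundamentalGroupoid X
  have hone (Q : Costacks.OpenFunctor X) (hQ : Costacks.IsCostack Q) :
      Costacks.IsContractible (Q ⟶ Costacks.constOne X) :=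
    Costacks.isContractible_hom hQ hX.isBase fun _ _ => Costacks.isContractible_constOne _
  have hpi (Q : Costacks.OpenFunctor X) (hQ : Costacks.IsCostack Q) :
      Costacks.IsContractible (Q ⟶ Costacks.fundamentalGroupoid X) :=
    Costacks.isContractible_hom hQ hX.isBase fun _ hS =>
      Costacks.isContractible_fundamentalGroupoid hS
  refine ⟨⟨(hone _ hpi₁).1.some, hpi₁, fun Q hQ => (hpi Q hQ).isEquivalence (hone Q hQ) _⟩, hpi₁,
    Costacks.isTwoTerminal_of_isContractible fun Q => ?_⟩
  obtain ⟨⟨f⟩, h⟩ := hpi Q.toOpenFunctor Q.isCostack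
  exact ⟨⟨InducedBicategory.mkHom f⟩, fun f g =>
    ⟨{ default := ⟨(h f.hom g.hom).some.default⟩
       uniq _ := InducedBicategory.hom₂_ext ((hpi Q.toOpenFunctor Q.isCostack).hom_eq _ _) }⟩⟩
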